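/- Work in intensional Martin-Löf type theory with dependent function types, a cumulative hierarchy of universes $\mathcal U_0:\mathcal U_1:\cdots$, empty type $\mathbf 0$, unit type, natural numbers, disjoint sums, dependent pair types and identity types, and with function extensionality for types of any size. Fix one universe $\mathcal U=\mathcal U_k$ of the hierarchy, and assume that $\mathcal U$ is univalent and closed under graph quotients (with an induction principle into type families of any size). No propositional truncation and no other higher inductive types are assumed. For types $A,B:\mathcal U$ let the join $A*B$ be the pushout of the two projections $A\leftarrow A\times B\to B$, and let $\mathsf{inr}:B\to A*B$ be the canonical map. Pushouts and sequential colimits are constructed as graph quotients. For $A:\mathcal U$ let $\|A\|_{-1}$ be the sequential colimit of $$\mathbf 0\longrightarrow A\xrightarrow{\ \mathsf{inr}\ }A*A\xrightarrow{\ \mathsf{inr}\ }A*(A*A)\xrightarrow{\ \mathsf{inr}\ }\cdots ,$$ and let $\eta_A:A\to\|A\|_{-1}$ be the inclusion of the stage $A$ of this sequence. **Corollary.** For $A:\mathcal U$ we have $\|A\|_{-1}:\mathcal U$ and $\eta_A:A\to\|A\|_{-1}$, and the following types are inhabited (by closed terms, uniformly in $A$ and $B$): 1. $\prod_{A:\mathcal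 U}\mathsf{isProp}(\|A\|_{-1})$, that is, $\|A\|_{-1}$ is a mere proposition; 2. for every universe $\mathcal U_j$, the type $\prod_{A:\mathcal U}\prod_{B:\mathcal U_j}\mathsf{isProp}(B)\to\mathsf{isEquiv}\big(({-}\circ\eta_A):(\|A\|_{-1}\to B)\to(A\to B)\big)$, that is, $\|A\|_{-1}$ has the universal property of the propositional truncation of $A$ with respect to mere propositions of any size. -/

import Mathlib

/-!
# Homotopy type theory as a formal system

The formal system is Martin-Löf type theory in the style in which homotopy type theory is usually
presented: a lambda calculus with dependent function types, a cumulative hierarchy of universes,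
and primitive constants for the other type formers, with their introduction and elimination
operators. Convertibility is the congruence generated by `β`, `η` and the computation rules of the
eliminators.

A number `k` singles out the universe `U k`, which is assumed to be univalent and closed under
graph quotients. Neither univalence nor graph quotients are assumed for any other universe; the
other universes serve only to speak about types of any size. Function extensionality holds for
types of any size.
-/

namespace HoTT

/-- The primitive constants: empty type, unit type, natural numbers, disjoint sums, dependent pair
types, identity types, graph quotients, and the axioms of function extensionality and
univalence. -/
inductive Const : Type
  | empty | emptyElim
  | unit | star | unitElim
  | nat | zero | succ | natElim
  | sum | inl | inr | sumElim
  | sig | pair | sigElim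
  | id | refl | idElim
  | gq | vert | edge | gqElim | gqElimEdge
  | funext
  | univalence
  deriving DecidableEq

/-- Raw terms, with de Bruijn indices. `pi A B` and `lam b` bind one variable in `B` and `b`. -/
inductive Tm : Type
  | var (n : ℕ)
  | univ (i : ℕ)
  | const (c : Const)
  | pi (A B : Tm)
  | lam (b : Tm)
  | app (f a : Tm)
  deriving DecidableEq

namespace Tm

/-- Application of terms is written by juxtaposition. -/
instance : CoeFun Tm (fun _ => Tm → Tm) := ⟨Tm.app⟩

/-- Extension of a renaming under a binder. -/
def up (ρ : ℕ → ℕ) : ℕ → ℕ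
  | 0 => 0
  | n + 1 => ρ n + 1

/-- Renaming of variables. -/
def rename : (ℕ → ℕ) → Tm → Tm
  | ρ, var n => var (ρ n)
  | _, univ i => univ i
  | _, const c => const c
  | ρ, pi A B => pi (rename ρ A) (rename (up ρ) B)
  | ρ, lam b => lam (rename (up ρ) b)
  | ρ, app f a => app (rename ρ f) (rename ρ a)

/-- Extension of a substitution under a binder. -/
def ups (σ : ℕ → Tm) : ℕ → Tm
  | 0 => var 0
  | n + 1 => rename Nat.succ (σ n)

/-- Simultaneous (capture-avoiding) substitution. -/
def subst : (ℕ → Tm) → Tm → Tm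
  | σ, var n => σ n
  | _, univ i => univ i
  | _, const c => const c
  | σ, pi A B => pi (subst σ A) (subst (ups σ) B)
  | σ, lam b => lam (subst (ups σ) b)
  | σ, app f a => app (subst σ f) (subst σ a)

/-- The substitution of `a` for the variable `0`, the other variables being shifted down. -/
def single (a : Tm) : ℕ → Tm
  | 0 => a
  | n + 1 => var n

/-- `b.inst a` is `b[a/x]` where `x` is the variable `0` of `b`. -/
def inst (b a : Tm) : Tm := subst (single a) b

end Tm

/-- Convertibility of terms: the congruence generated by `β`, `η` and the computation rules. -/
inductive Conv : Tm → Tm → Prop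
  | refl (t : Tm) : Conv t t
  | symm {t u : Tm} : Conv t u → Conv u t
  | trans {t u v : Tm} : Conv t u → Conv u v → Conv t v
  | pi {A A' B B' : Tm} : Conv A A' → Conv B B' → Conv (Tm.pi A B) (Tm.pi A' B')
  | lam {b b' : Tm} : Conv b b' → Conv (Tm.lam b) (Tm.lam b')
  | app {f f' a a' : Tm} : Conv f f' → Conv a a' → Conv (Tm.app f a) (Tm.app f' a')
  | beta (b a : Tm) : Conv (Tm.app (Tm.lam b) a) (b.inst a)
  | eta (f : Tm) : Conv (Tm.lam (Tm.app (f.rename Nat.succ) (Tm.var 0))) f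
  | unit_star (C c : Tm) :
      Conv (Tm.const .unitElim C c (Tm.const .star)) c
  | nat_zero (C z s : Tm) :
      Conv (Tm.const .natElim C z s (Tm.const .zero)) z
  | nat_succ (C z s n : Tm) :
      Conv (Tm.const .natElim C z s (Tm.const .succ n)) (s n (Tm.const .natElim C z s n))
  | sum_inl (A B C l r a : Tm) :
      Conv (Tm.const .sumElim A B C l r (Tm.const .inl A B a)) (l a)
  | sum_inr (A B C l r b : Tm) :
      Conv (Tm.const .sumElim A B C l r (Tm.const .inr A B b)) (r b)
  | sig_pair (A B C c a b : Tm) :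
      Conv (Tm.const .sigElim A B C c (Tm.const .pair A B a b)) (c a b)
  | id_refl (A C c a : Tm) :
      Conv (Tm.const .idElim A C c a a (Tm.const .refl A a)) (c a)
  | gq_vert (V E C c p v : Tm) :
      Conv (Tm.const .gqElim V E C c p (Tm.const .vert V E v)) (c v)

/-! ### Writing down terms with named variables

An `Exp` is a term that may be placed under any number of further binders: it is given by its de
Bruijn representation under `d` binders, for every `d`. This makes it possible to write
`pi A fun x => B` and `lam fun x => b` with a variable `x` of the metalanguage. -/

/-- Terms with named variables, see above. -/
structure Exp : Type where
  /-- the raw term that represents the expression under `d` binders -/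
  under : ℕ → Tm

namespace Exp

/-- The closed term given by a closed expression. -/
def close (t : Exp) : Tm := t.under 0

/-- The variable that is bound by the binder which itself is under `d` binders. -/
def bvar (d : ℕ) : Exp := ⟨fun e => Tm.var (e - (d + 1))⟩

/-- Application. -/
def app (f a : Exp) : Exp := ⟨fun d => Tm.app (f.under d) (a.under d)⟩

/-- Application of expressions is written by juxtaposition. -/
instance : CoeFun Exp (fun _ => Exp → Exp) := ⟨Exp.app⟩

/-- The lambda abstraction `λ x, b x`. -/
def lam (b : Exp → Exp) : Exp := ⟨fun d => Tm.lam ((b (bvar d)).under (d + 1))⟩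

/-- The dependent function type `Π (x : A), B x`. -/
def pi (A : Exp) (B : Exp → Exp) : Exp :=
  ⟨fun d => Tm.pi (A.under d) ((B (bvar d)).under (d + 1))⟩

/-- The function type `A → B`. -/
def arr (A B : Exp) : Exp := pi A fun _ => B

/-- The universe `U i`. -/
def U (i : ℕ) : Exp := ⟨fun _ => Tm.univ i⟩

/-- A primitive constant. -/
def cst (c : Const) : Exp := ⟨fun _ => Tm.const c⟩

/-- The empty type. -/
def empty : Exp := cst .empty

/-- The type of natural numbers. -/
def nat : Exp := cst .nat

/-- The number zero. -/
def zero : Exp := cst .zero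

/-- The successor of `n`. -/
def succ (n : Exp) : Exp := cst .succ n

/-- The dependent pair type `Σ (x : A), B x`. -/
def sig (A : Exp) (B : Exp → Exp) : Exp := cst .sig A (lam B)

/-- The pair `(a, b)` in `Σ (x : A), B x`. -/
def pair (A : Exp) (B : Exp → Exp) (a b : Exp) : Exp := cst .pair A (lam B) a b

/-- The cartesian product `A × B`. -/
def prod (A B : Exp) : Exp := sig A fun _ => B

/-- The first projection of `s : Σ (x : A), B x`. -/
def fst (A : Exp) (B : Exp → Exp) (s : Exp) : Exp :=
  cst .sigElim A (lam B) (lam fun _ => A) (lam fun a => lam fun _ => a) s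

/-- The second projection of `s : Σ (x : A), B x`. -/
def snd (A : Exp) (B : Exp → Exp) (s : Exp) : Exp :=
  cst .sigElim A (lam B) (lam fun z => B (fst A B z)) (lam fun _ => lam fun b => b) s

/-- The disjoint sum `A + B`. -/
def sum (A B : Exp) : Exp := cst .sum A B

/-- The identity type `x =_A y`. -/
def eq (A x y : Exp) : Exp := cst .id A x y

/-- Reflexivity at `x : A`. -/
def refl (A x : Exp) : Exp := cst .refl A x

/-- Transport of `u : P x` along `p : x =_A y`. -/
def transport (A : Exp) (P : Exp → Exp) (x y p u : Exp) : Exp :=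
  cst .idElim A (lam fun x => lam fun y => lam fun _ => arr (P x) (P y))
    (lam fun _ => lam fun u => u) x y p u

/-- The dependent action `transport p (f x) = f y` of `f : Π (x : A), P x` on `p : x =_A y`. -/
def apd (A : Exp) (P : Exp → Exp) (f x y p : Exp) : Exp :=
  cst .idElim A
    (lam fun x => lam fun y => lam fun p => eq (P y) (transport A P x y p (f x)) (f y))
    (lam fun x => refl (P x) (f x)) x y p

/-- `A` is a mere proposition. -/
def isProp (A : Exp) : Exp := pi A fun x => pi A fun y => eq A x y

/-- `f : A → B` is an equivalence: it has a right inverse and a left inverse. -/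
def isEquiv (A B f : Exp) : Exp :=
  prod (sig (arr B A) fun g => pi B fun b => eq B (f (g b)) b)
    (sig (arr B A) fun h => pi A fun a => eq A (h (f a)) a)

/-- The type `A ≃ B` of equivalences. -/
def equiv (A B : Exp) : Exp := sig (arr A B) fun f => isEquiv A B f

/-- The identity equivalence `A ≃ A`. -/
def idEquiv (A : Exp) : Exp :=
  pair (arr A A) (fun f => isEquiv A A f) (lam fun x => x)
    (pair (sig (arr A A) fun g => pi A fun b => eq A ((lam fun x => x) (g b)) b)
      (fun _ => sig (arr A A) fun h => pi A fun a => eq A (h ((lam fun x => x) a)) a)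
      (pair (arr A A) (fun g => pi A fun b => eq A ((lam fun x => x) (g b)) b)
        (lam fun x => x) (lam fun b => refl A b))
      (pair (arr A A) (fun h => pi A fun a => eq A (h ((lam fun x => x) a)) a)
        (lam fun x => x) (lam fun a => refl A a)))

/-- The canonical map `(f = g) → Π (x : A), f x = g x`. -/
def happly (A : Exp) (B : Exp → Exp) (f g : Exp) : Exp :=
  lam fun p => cst .idElim (pi A B)
    (lam fun f => lam fun g => lam fun _ => pi A fun x => eq (B x) (f x) (g x))
    (lam fun f => lam fun x => refl (B x) (f x)) f g p

/-- The canonical map `(A = B) → (A ≃ B)` for `A B : U k`. -/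
def idToEquiv (k : ℕ) (A B : Exp) : Exp :=
  lam fun p => cst .idElim (U k) (lam fun A => lam fun B => lam fun _ => equiv A B)
    (lam fun A => idEquiv A) A B p

/-- The graph quotient of the graph with vertices `V` and edges `E : V → V → U k`. -/
def gq (V E : Exp) : Exp := cst .gq V E

/-- The point constructor of the graph quotient. -/
def vert (V E v : Exp) : Exp := cst .vert V E v

/-- The path constructor of the graph quotient, for an edge `e : E v w`. -/
def edge (V E v w e : Exp) : Exp := cst .edge V E v w e

/-- The type of the path data in the induction principle of the graph quotient. -/
def gqPathData (V E C c : Exp) : Exp :=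
  pi V fun v => pi V fun w => pi (E v w) fun e =>
    eq (C (vert V E w))
      (transport (gq V E) (fun z => C z) (vert V E v) (vert V E w) (edge V E v w e) (c v)) (c w)

end Exp

open Exp in
/-- The types of the primitive constants. The constants are typically ambiguous: they have this
type for all levels `i` and `j`. -/
def constType (k i j : ℕ) : Const → Exp
  | .empty => U 0
  | .emptyElim => pi (arr empty (U j)) fun C => pi empty fun x => C x
  | .unit => U 0
  | .star => cst .unit
  | .unitElim => pi (arr (cst .unit) (U j)) fun C => arr (C (cst .star)) (pi (cst .unit) fun x => C x)
  | .nat => U 0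
  | .zero => nat
  | .succ => arr nat nat
  | .natElim => pi (arr nat (U j)) fun C =>
      arr (C zero) (arr (pi nat fun n => arr (C n) (C (succ n))) (pi nat fun n => C n))
  | .sum => arr (U i) (arr (U i) (U i))
  | .inl => pi (U i) fun A => pi (U i) fun B => arr A (sum A B)
  | .inr => pi (U i) fun A => pi (U i) fun B => arr B (sum A B)
  | .sumElim => pi (U i) fun A => pi (U i) fun B => pi (arr (sum A B) (U j)) fun C =>
      arr (pi A fun a => C (cst .inl A B a)) (arr (pi B fun b => C (cst .inr A B b))
        (pi (sum A B) fun x => C x))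
  | .sig => pi (U i) fun A => arr (arr A (U i)) (U i)
  | .pair => pi (U i) fun A => pi (arr A (U i)) fun B =>
      pi A fun a => arr (B a) (cst .sig A B)
  | .sigElim => pi (U i) fun A => pi (arr A (U i)) fun B => pi (arr (cst .sig A B) (U j)) fun C =>
      arr (pi A fun a => pi (B a) fun b => C (cst .pair A B a b)) (pi (cst .sig A B) fun x => C x)
  | .id => pi (U i) fun A => arr A (arr A (U i))
  | .refl => pi (U i) fun A => pi A fun a => eq A a a
  | .idElim => pi (U i) fun A =>
      pi (pi A fun x => pi A fun y => arr (eq A x y) (U j)) fun C =>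
        arr (pi A fun x => C x x (refl A x))
          (pi A fun x => pi A fun y => pi (eq A x y) fun p => C x y p)
  | .gq => pi (U k) fun V => arr (arr V (arr V (U k))) (U k)
  | .vert => pi (U k) fun V => pi (arr V (arr V (U k))) fun E => arr V (gq V E)
  | .edge => pi (U k) fun V => pi (arr V (arr V (U k))) fun E => pi V fun v => pi V fun w =>
      arr (E v w) (eq (gq V E) (vert V E v) (vert V E w))
  | .gqElim => pi (U k) fun V => pi (arr V (arr V (U k))) fun E => pi (arr (gq V E) (U j)) fun C =>
      pi (pi V fun v => C (vert V E v)) fun c =>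
        arr (gqPathData V E C c) (pi (gq V E) fun z => C z)
  | .gqElimEdge =>
      pi (U k) fun V => pi (arr V (arr V (U k))) fun E => pi (arr (gq V E) (U j)) fun C =>
        pi (pi V fun v => C (vert V E v)) fun c => pi (gqPathData V E C c) fun p =>
          pi V fun v => pi V fun w => pi (E v w) fun e =>
            eq (eq (C (vert V E w))
                (transport (gq V E) (fun z => C z) (vert V E v) (vert V E w) (edge V E v w e) (c v))
                (c w))
              (apd (gq V E) (fun z => C z) (cst .gqElim V E C c p)
                (vert V E v) (vert V E w) (edge V E v w e))
              (p v w e)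
  | .funext => pi (U i) fun A => pi (arr A (U i)) fun B =>
      pi (pi A fun x => B x) fun f => pi (pi A fun x => B x) fun g =>
        isEquiv (eq (pi A fun x => B x) f g) (pi A fun x => eq (B x) (f x) (g x))
          (happly A (fun x => B x) f g)
  | .univalence => pi (U k) fun A => pi (U k) fun B =>
      isEquiv (eq (U k) A B) (equiv A B) (idToEquiv k A B)

/-- `HasType k Γ t A` is the judgment `Γ ⊢ t : A` of type theory with the univalent universe `U k`
closed under graph quotients. A context lists the types of its variables, the most recent one
first. Contexts are only ever extended by types, so that every context in a derivation that ends
in the empty context is well-formed. -/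
inductive HasType (k : ℕ) : List Tm → Tm → Tm → Prop
  | var {Γ : List Tm} {n : ℕ} {A : Tm} : Γ[n]? = some A →
      HasType k Γ (Tm.var n) (A.rename (fun m => m + (n + 1)))
  | univ {Γ : List Tm} (i : ℕ) : HasType k Γ (Tm.univ i) (Tm.univ (i + 1))
  | cumul {Γ : List Tm} {A : Tm} {i : ℕ} :
      HasType k Γ A (Tm.univ i) → HasType k Γ A (Tm.univ (i + 1))
  | const {Γ : List Tm} (c : Const) (i j : ℕ) :
      HasType k Γ (Tm.const c) (constType k i j c).close
  | pi {Γ : List Tm} {A B : Tm} {i : ℕ} : HasType k Γ A (Tm.univ i) →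
      HasType k (A :: Γ) B (Tm.univ i) → HasType k Γ (Tm.pi A B) (Tm.univ i)
  | lam {Γ : List Tm} {A B b : Tm} {i : ℕ} : HasType k Γ A (Tm.univ i) →
      HasType k (A :: Γ) b B → HasType k Γ (Tm.lam b) (Tm.pi A B)
  | app {Γ : List Tm} {A B f a : Tm} : HasType k Γ f (Tm.pi A B) →
      HasType k Γ a A → HasType k Γ (Tm.app f a) (B.inst a)
  | conv {Γ : List Tm} {t A B : Tm} {i : ℕ} : HasType k Γ t A → Conv A B →
      HasType k Γ B (Tm.univ i) → HasType k Γ t B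

/-- A closed type is inhabited if it has a closed term. -/
def IsInhabited (k : ℕ) (A : Exp) : Prop := ∃ t : Tm, HasType k [] t A.close

/-! ### Pushouts, joins, sequential colimits and the propositional truncation -/

namespace Exp

/-- The edges of the graph whose quotient is the pushout of `X ← S → Y`: an edge from `v` to `w`
in `X + Y` is some `s : S` with `inl (f s) = v` and `inr (g s) = w`. -/
def pushoutEdges (S X Y f g : Exp) : Exp :=
  lam fun v => lam fun w => sig S fun s =>
    prod (eq (sum X Y) (cst .inl X Y (f s)) v) (eq (sum X Y) (cst .inr X Y (g s)) w)

/-- The pushout of `f : S → X` and `g : S → Y`, the homotopy coequalizer of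
`inl ∘ f, inr ∘ g : S → X + Y`. -/
def pushout (S X Y f g : Exp) : Exp := gq (sum X Y) (pushoutEdges S X Y f g)

/-- The canonical map from `Y` to the pushout. -/
def pushoutInr (S X Y f g y : Exp) : Exp :=
  vert (sum X Y) (pushoutEdges S X Y f g) (cst .inr X Y y)

/-- The join `A * B`, the pushout of the projections of `A × B`. -/
def join (A B : Exp) : Exp :=
  pushout (prod A B) A B (lam fun s => fst A (fun _ => B) s) (lam fun s => snd A (fun _ => B) s)

/-- The canonical map `B → A * B`. -/
def joinInr (A B b : Exp) : Exp :=
  pushoutInr (prod A B) A B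
    (lam fun s => fst A (fun _ => B) s) (lam fun s => snd A (fun _ => B) s) b

/-- The vertices `Σ (n : ℕ), X n` of the graph of a type sequence. -/
def seqVertices (X : Exp) : Exp := sig nat fun n => X n

/-- The edges of the graph of a type sequence `X : ℕ → U`, `f : Π n, X n → X (n + 1)`: an edge from
`(n, x)` to `(m, y)` is some `p : n + 1 = m` with `transport p (f n x) = y`. -/
def seqEdges (X f : Exp) : Exp :=
  lam fun v => lam fun w =>
    let fst (z : Exp) : Exp := fst nat (fun n => X n) z
    let snd (z : Exp) : Exp := snd nat (fun n => X n) z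
    sig (eq nat (succ (fst v)) (fst w)) fun p =>
      eq (X (fst w)) (transport nat (fun n => X n) (succ (fst v)) (fst w) p (f (fst v) (snd v)))
        (snd w)

/-- The sequential colimit of a type sequence. -/
def seqColim (X f : Exp) : Exp := gq (seqVertices X) (seqEdges X f)

/-- The canonical map from `X n` to the sequential colimit. -/
def seqIn (X f n x : Exp) : Exp :=
  vert (seqVertices X) (seqEdges X f) (pair nat (fun n => X n) n x)

/-- The sequence `A`, `A * A`, `A * (A * A)`, … as a function `ℕ → U k`. -/
def joinPower (k : ℕ) (A : Exp) : Exp :=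
  lam fun n => cst .natElim (lam fun _ => U k) A (lam fun _ => lam fun P => join A P) n

/-- The sequence `0`, `A`, `A * A`, `A * (A * A)`, … as a function `ℕ → U k`. -/
def joinSeq (k : ℕ) (A : Exp) : Exp :=
  lam fun n => cst .natElim (lam fun _ => U k) empty (lam fun m => lam fun _ => joinPower k A m) n

/-- The maps of the sequence `0 → A → A * A → A * (A * A) → …`: the first one is the unique map,
the others are `inr`. -/
def joinSeqMap (k : ℕ) (A : Exp) : Exp :=
  lam fun n => cst .natElim (lam fun n => arr (joinSeq k A n) (joinSeq k A (succ n)))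
    (lam fun x => cst .emptyElim (lam fun _ => A) x)
    (lam fun m => lam fun _ => lam fun x => joinInr A (joinPower k A m) x) n

/-- The propositional truncation of `A`: the sequential colimit of
`0 → A → A * A → A * (A * A) → …`. -/
def trunc (k : ℕ) (A : Exp) : Exp := seqColim (joinSeq k A) (joinSeqMap k A)

/-- The canonical map `A → trunc A`, the inclusion of the first stage (the stage zero being the
empty type). -/
def truncIn (k : ℕ) (A a : Exp) : Exp :=
  seqIn (joinSeq k A) (joinSeqMap k A) (succ zero) a

end Exp

end HoTT

/-! The homotopical argument has two halves that meet in one trick. If `A` has a point `a`, all maps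
of the sequence are null-homotopic: the first because its domain is empty, every `inr` because the
join has a path from `inl a` to `inr x`. The colimit of such a sequence contracts onto its first
base point (`nullSeqInd`, resting on `seqCoherence`), so there is a map from `A` to `isProp (trunc
A)`. Conversely, a map from `A` to a mere proposition extends to all join powers by induction, and
then to the colimit (`truncToProp`), because the path data for eliminating a graph quotient into a
mere proposition is automatic. By function extensionality `isProp (trunc A)` is itself a mere
proposition, so the map from `A` extends to `trunc A → isProp (trunc A)`; a type that is a mere
proposition as soon as it has a point is one (`isPropOfExtension`). In the universal property,
extension is inverse to precomposition by function extensionality and because the target is a mere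
proposition (`precompEquiv`).

The theorem asserts that derivations exist in a formal calculus. They come from a type checker that
is proved sound (`checker_sound`) and evaluated by the kernel on explicit terms. The terms are
checked one at a time; each accepted term joins a signature and is available to the later ones.

The checker works only with `k = 0` and `B : U 1`. Typing is stable under strictly monotone maps of
universe levels (`HasType.mapLevels`), which carries the result to `U k` and arbitrarily large
universes for `B`; cumulativity then gives every `U j`. -/

namespace HoTT

/-! ### Renaming, substitution and change of levels for raw terms. -/

namespace Tm

theorem up_comp (ρ ρ' : ℕ → ℕ) : up (ρ' ∘ ρ) = up ρ' ∘ up ρ := by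
  funext n; cases n <;> rfl

theorem rename_rename (t : Tm) : ∀ ρ ρ' : ℕ → ℕ, rename ρ' (rename ρ t) = rename (ρ' ∘ ρ) t := by
  induction t with
  | pi A B hA hB => intro ρ ρ'; simp [rename, up_comp, hA, hB]
  | lam b hb => intro ρ ρ'; simp [rename, up_comp, hb]
  | app f a hf ha => intro ρ ρ'; simp [rename, hf, ha]
  | _ => intros; rfl

theorem ups_comp_up (ρ : ℕ → ℕ) (σ : ℕ → Tm) : ups (σ ∘ ρ) = ups σ ∘ up ρ := by
  funext n; cases n <;> rfl

theorem subst_rename (t : Tm) :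
    ∀ (ρ : ℕ → ℕ) (σ : ℕ → Tm), subst σ (rename ρ t) = subst (σ ∘ ρ) t := by
  induction t with
  | pi A B hA hB => intro ρ σ; simp [rename, subst, ups_comp_up, hA, hB]
  | lam b hb => intro ρ σ; simp [rename, subst, ups_comp_up, hb]
  | app f a hf ha => intro ρ σ; simp [rename, subst, hf, ha]
  | _ => intros; rfl

theorem ups_rename_comp (ρ : ℕ → ℕ) (σ : ℕ → Tm) :
    ups (rename ρ ∘ σ) = rename (up ρ) ∘ ups σ := by
  funext n
  cases n with
  | zero => rfl
  | succ n => simp only [ups, Function.comp, rename_rename]; rfl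

theorem rename_subst (t : Tm) :
    ∀ (ρ : ℕ → ℕ) (σ : ℕ → Tm), rename ρ (subst σ t) = subst (rename ρ ∘ σ) t := by
  induction t with
  | pi A B hA hB => intro ρ σ; simp [rename, subst, ups_rename_comp, hA, hB]
  | lam b hb => intro ρ σ; simp [rename, subst, ups_rename_comp, hb]
  | app f a hf ha => intro ρ σ; simp [rename, subst, hf, ha]
  | _ => intros; rfl

theorem ups_subst_comp (σ τ : ℕ → Tm) : ups (subst τ ∘ σ) = subst (ups τ) ∘ ups σ := by
  funext n
  cases n with
  | zero => rfl
  | succ n => simp only [ups, Function.comp, rename_subst, subst_rename]; rfl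

theorem subst_subst (t : Tm) :
    ∀ σ τ : ℕ → Tm, subst τ (subst σ t) = subst (subst τ ∘ σ) t := by
  induction t with
  | pi A B hA hB => intro σ τ; simp [subst, ups_subst_comp, hA, hB]
  | lam b hb => intro σ τ; simp [subst, ups_subst_comp, hb]
  | app f a hf ha => intro σ τ; simp [subst, hf, ha]
  | _ => intros; rfl

theorem ups_var : ups var = var := by
  funext n; cases n <;> rfl

theorem subst_var (t : Tm) : subst var t = t := by
  induction t with
  | pi A B hA hB => simp [subst, ups_var, hA, hB]
  | lam b hb => simp [subst, ups_var, hb]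
  | app f a hf ha => simp [subst, hf, ha]
  | _ => rfl

theorem rename_eq_subst (ρ : ℕ → ℕ) (t : Tm) : rename ρ t = subst (var ∘ ρ) t := by
  rw [← subst_rename, subst_var]

theorem inst_rename_succ (t a : Tm) : (rename Nat.succ t).inst a = t := by
  rw [inst, subst_rename]
  exact subst_var t

/-- This commutation makes the `β` rule, and the instantiated codomain in the application rule,
stable under substitution. -/
theorem inst_subst (b a : Tm) (σ : ℕ → Tm) :
    (b.inst a).subst σ = (b.subst (ups σ)).inst (a.subst σ) := by
  simp only [inst, subst_subst]
  congr 1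
  funext n
  cases n with
  | zero => rfl
  | succ n => exact (inst_rename_succ (σ n) (a.subst σ)).symm

theorem rename_succ_subst (t : Tm) (σ : ℕ → Tm) :
    (rename Nat.succ t).subst (ups σ) = (t.subst σ).rename Nat.succ := by
  rw [subst_rename, rename_subst]
  rfl

theorem inst_rename (b a : Tm) (ρ : ℕ → ℕ) :
    (b.inst a).rename ρ = (b.rename (up ρ)).inst (a.rename ρ) := by
  have h : var ∘ up ρ = ups (var ∘ ρ) := by funext n; cases n <;> rfl
  simp only [rename_eq_subst, inst_subst, h]

theorem rename_succ_rename (t : Tm) (ρ : ℕ → ℕ) :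
    (rename Nat.succ t).rename (up ρ) = (t.rename ρ).rename Nat.succ := by
  simp only [rename_rename]
  rfl

/-- Replacement of the universe levels in a term. -/
def mapLevels (φ : ℕ → ℕ) : Tm → Tm
  | var n => var n
  | univ i => univ (φ i)
  | const c => const c
  | pi A B => pi (mapLevels φ A) (mapLevels φ B)
  | lam b => lam (mapLevels φ b)
  | app f a => app (mapLevels φ f) (mapLevels φ a)

theorem mapLevels_rename (φ : ℕ → ℕ) (t : Tm) :
    ∀ ρ : ℕ → ℕ, mapLevels φ (rename ρ t) = rename ρ (mapLevels φ t) := by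
  induction t <;> simp_all [rename, mapLevels]

theorem ups_mapLevels (φ : ℕ → ℕ) (σ : ℕ → Tm) :
    ups (mapLevels φ ∘ σ) = mapLevels φ ∘ ups σ := by
  funext n
  cases n with
  | zero => rfl
  | succ n => simp [ups, mapLevels_rename]

theorem mapLevels_subst (φ : ℕ → ℕ) (t : Tm) :
    ∀ σ : ℕ → Tm, mapLevels φ (subst σ t) = subst (mapLevels φ ∘ σ) (mapLevels φ t) := by
  induction t <;> simp_all [subst, mapLevels, ups_mapLevels]

theorem mapLevels_inst (φ : ℕ → ℕ) (b a : Tm) :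
    mapLevels φ (b.inst a) = (mapLevels φ b).inst (mapLevels φ a) := by
  rw [inst, mapLevels_subst, inst]
  congr 1
  funext n
  cases n <;> rfl

end Tm

open Tm

/-! ### Stability of convertibility. -/

namespace Conv

theorem subst {t u : Tm} (h : Conv t u) : ∀ σ : ℕ → Tm, Conv (t.subst σ) (u.subst σ) := by
  induction h with
  | refl t => exact fun σ => .refl _
  | symm _ h => exact fun σ => (h σ).symm
  | trans _ _ h h' => exact fun σ => (h σ).trans (h' σ)
  | pi _ _ h h' => exact fun σ => .pi (h σ) (h' _)
  | lam _ h => exact fun σ => .lam (h _)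
  | app _ _ h h' => exact fun σ => .app (h σ) (h' σ)
  | beta b a => intro σ; rw [inst_subst]; exact .beta _ _
  | eta f =>
    intro σ
    have := Conv.eta (f.subst σ)
    rw [← rename_succ_subst] at this
    exact this
  | unit_star => exact fun σ => .unit_star _ _
  | nat_zero => exact fun σ => .nat_zero _ _ _
  | nat_succ => exact fun σ => .nat_succ _ _ _ _
  | sum_inl => exact fun σ => .sum_inl _ _ _ _ _ _
  | sum_inr => exact fun σ => .sum_inr _ _ _ _ _ _
  | sig_pair => exact fun σ => .sig_pair _ _ _ _ _ _
  | id_refl => exact fun σ => .id_refl _ _ _ _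
  | gq_vert => exact fun σ => .gq_vert _ _ _ _ _ _

theorem rename {t u : Tm} (h : Conv t u) (ρ : ℕ → ℕ) : Conv (t.rename ρ) (u.rename ρ) := by
  simp only [rename_eq_subst]
  exact h.subst _

theorem mapLevels {t u : Tm} (φ : ℕ → ℕ) (h : Conv t u) :
    Conv (t.mapLevels φ) (u.mapLevels φ) := by
  induction h with
  | refl t => exact .refl _
  | symm _ h => exact h.symm
  | trans _ _ h h' => exact h.trans h'
  | pi _ _ h h' => exact .pi h h'
  | lam _ h => exact .lam h
  | app _ _ h h' => exact .app h h'
  | beta b a => rw [mapLevels_inst]; exact .beta _ _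
  | eta f =>
    have := Conv.eta (f.mapLevels φ)
    rw [← mapLevels_rename] at this
    exact this
  | unit_star => exact .unit_star _ _
  | nat_zero => exact .nat_zero _ _ _
  | nat_succ => exact .nat_succ _ _ _ _
  | sum_inl => exact .sum_inl _ _ _ _ _ _
  | sum_inr => exact .sum_inr _ _ _ _ _ _
  | sig_pair => exact .sig_pair _ _ _ _ _ _
  | id_refl => exact .id_refl _ _ _ _
  | gq_vert => exact .gq_vert _ _ _ _ _ _

end Conv

/-- The type of a constant is a closed term whose shape does not depend on the levels, so each case
holds by computation. -/
theorem rename_constType (k i j : ℕ) (c : Const) (ρ : ℕ → ℕ) :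
    (constType k i j c).close.rename ρ = (constType k i j c).close := by
  cases c <;> rfl

theorem subst_constType (k i j : ℕ) (c : Const) (σ : ℕ → Tm) :
    (constType k i j c).close.subst σ = (constType k i j c).close := by
  cases c <;> rfl

/-! ### Admissible rules of the typing judgment. -/

namespace HasType

variable {k : ℕ} {Γ Δ : List Tm}

theorem cumul_le {A : Tm} {i j : ℕ} (h : HasType k Γ A (Tm.univ i)) (hij : i ≤ j) :
    HasType k Γ A (Tm.univ j) := by
  induction hij with
  | refl => exact h
  | step _ ih => exact ih.cumul

/-- A context entry is a term over the entries behind it, so entries are compared after shifting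
them to the whole context. The auxiliary `lift` carries the hypothesis on `ρ` under a binder. -/
theorem rename {t A : Tm} (h : HasType k Γ t A) : ∀ {Δ : List Tm} {ρ : ℕ → ℕ},
    (∀ n B, Γ[n]? = some B → ∃ B', Δ[ρ n]? = some B' ∧
      B'.rename (fun m => m + (ρ n + 1)) = (B.rename fun m => m + (n + 1)).rename ρ) →
    HasType k Δ (t.rename ρ) (A.rename ρ) := by
  have lift : ∀ {Γ Δ : List Tm} {ρ : ℕ → ℕ} (A : Tm),
      (∀ n B, Γ[n]? = some B → ∃ B', Δ[ρ n]? = some B' ∧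
        B'.rename (fun m => m + (ρ n + 1)) = (B.rename fun m => m + (n + 1)).rename ρ) →
      (∀ n B, (A :: Γ)[n]? = some B → ∃ B', (A.rename ρ :: Δ)[up ρ n]? = some B' ∧
        B'.rename (fun m => m + (up ρ n + 1)) =
          (B.rename fun m => m + (n + 1)).rename (up ρ)) := by
    intro Γ Δ ρ A h n B hn
    cases n with
    | zero =>
      obtain rfl : A = B := by simpa using hn
      exact ⟨A.rename ρ, rfl, (rename_succ_rename A ρ).symm⟩
    | succ n =>
      obtain ⟨B', hB', e⟩ := h n B (by simpa using hn)
      refine ⟨B', by simpa [up] using hB', ?_⟩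
      have e' := congrArg (Tm.rename Nat.succ) e
      rw [← rename_succ_rename] at e'
      simp only [rename_rename] at e' ⊢
      exact e'
  induction h with
  | @var Γ n A hn =>
    intro Δ ρ hρ
    obtain ⟨B', hB', e⟩ := hρ n A hn
    rw [← e]
    exact .var hB'
  | univ i => exact fun _ => .univ i
  | cumul _ ih => exact fun hρ => .cumul (ih hρ)
  | const c i j => intro Δ ρ _; rw [rename_constType]; exact .const c i j
  | pi _ _ ihA ihB => exact fun hρ => .pi (ihA hρ) (ihB (lift _ hρ))
  | lam _ _ ihA ihb => exact fun hρ => .lam (ihA hρ) (ihb (lift _ hρ))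
  | app _ _ ihf iha => intro Δ ρ hρ; rw [inst_rename]; exact .app (ihf hρ) (iha hρ)
  | conv _ e _ iht ihB => exact fun hρ => .conv (iht hρ) (e.rename _) (ihB hρ)

theorem weaken {t A : Tm} (B : Tm) (h : HasType k Γ t A) :
    HasType k (B :: Γ) (t.rename Nat.succ) (A.rename Nat.succ) := by
  refine h.rename fun n C hn => ⟨C, by simpa using hn, ?_⟩
  rw [rename_rename]
  rfl

theorem subst {t A : Tm} (h : HasType k Γ t A) : ∀ {Δ : List Tm} {σ : ℕ → Tm},
    (∀ n B, Γ[n]? = some B →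
      HasType k Δ (σ n) ((B.rename fun m => m + (n + 1)).subst σ)) →
    HasType k Δ (t.subst σ) (A.subst σ) := by
  have lift : ∀ {Γ Δ : List Tm} {σ : ℕ → Tm} (A : Tm),
      (∀ n B, Γ[n]? = some B →
        HasType k Δ (σ n) ((B.rename fun m => m + (n + 1)).subst σ)) →
      (∀ n B, (A :: Γ)[n]? = some B →
        HasType k (A.subst σ :: Δ) (ups σ n)
          ((B.rename fun m => m + (n + 1)).subst (ups σ))) := by
    intro Γ Δ σ A h n B hn
    cases n with
    | zero =>
      obtain rfl : A = B := by simpa using hn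
      have := @HasType.var k (A.subst σ :: Δ) 0 (A.subst σ) rfl
      exact (rename_succ_subst A σ).symm ▸ this
    | succ n =>
      have := (h n B (by simpa using hn)).weaken (A.subst σ)
      rw [← rename_succ_subst, rename_rename] at this
      exact this
  induction h with
  | var hn => exact fun hσ => hσ _ _ hn
  | univ i => exact fun _ => .univ i
  | cumul _ ih => exact fun hσ => .cumul (ih hσ)
  | const c i j => intro Δ σ _; rw [subst_constType]; exact .const c i j
  | pi _ _ ihA ihB => exact fun hσ => .pi (ihA hσ) (ihB (lift _ hσ))
  | lam _ _ ihA ihb => exact fun hσ => .lam (ihA hσ) (ihb (lift _ hσ))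
  | app _ _ ihf iha => intro Δ σ hσ; rw [inst_subst]; exact .app (ihf hσ) (iha hσ)
  | conv _ e _ iht ihB => exact fun hσ => .conv (iht hσ) (e.subst _) (ihB hσ)

theorem inst {t A B a : Tm} (h : HasType k (A :: Γ) t B) (ha : HasType k Γ a A) :
    HasType k Γ (t.inst a) (B.inst a) := by
  refine h.subst fun n C hn => ?_
  cases n with
  | zero =>
    obtain rfl : A = C := by simpa using hn
    rw [subst_rename]
    exact (subst_var A).symm ▸ ha
  | succ n =>
    rw [subst_rename]
    have := @HasType.var k Γ n C (by simpa using hn)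
    rw [rename_eq_subst] at this
    exact this

/-- A derivation for a `pi` term ends in its formation rule, possibly followed by cumulativity and
conversion steps, which do not change the subject. -/
theorem pi_inv {A B : Tm} {T : Tm} (h : HasType k Γ (Tm.pi A B) T) :
    ∃ i, HasType k Γ A (Tm.univ i) ∧ HasType k (A :: Γ) B (Tm.univ i) := by
  generalize ht : Tm.pi A B = t at h
  induction h with
  | pi hA hB => cases ht; exact ⟨_, hA, hB⟩
  | cumul _ ih => exact ih ht
  | conv _ _ _ ih => exact ih ht
  | _ => cases ht

/-- A typed term only has variables listed in its context. For the empty context this makes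
weakening leave the term unchanged. -/
theorem rename_eq {t A : Tm} (h : HasType k Γ t A) :
    ∀ ρ : ℕ → ℕ, (∀ n < Γ.length, ρ n = n) → t.rename ρ = t := by
  have lift : ∀ {Γ : List Tm} {ρ : ℕ → ℕ} (A : Tm), (∀ n < Γ.length, ρ n = n) →
      ∀ n < (A :: Γ).length, up ρ n = n := by
    intro Γ ρ A h n hn
    cases n with
    | zero => rfl
    | succ n => simp [up, h n (by simpa using hn)]
  induction h with
  | var hn => exact fun ρ h => congrArg Tm.var (h _ (List.getElem?_eq_some_iff.1 hn).1)
  | univ i => exact fun _ _ => rfl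
  | cumul _ ih => exact ih
  | const c i j => exact fun _ _ => rfl
  | pi _ _ ihA ihB => intro ρ h; simp only [Tm.rename, ihA ρ h, ihB _ (lift _ h)]
  | lam _ _ _ ihb => intro ρ h; simp only [Tm.rename, ihb _ (lift _ h)]
  | app _ _ ihf iha => intro ρ h; simp only [Tm.rename, ihf ρ h, iha ρ h]
  | conv _ _ _ ih _ => exact ih

/-- A closed term of a closed type has this type in every context. -/
theorem of_closed {t A B : Tm} (h : HasType k [] t A) (hA : HasType k [] A B) (Γ : List Tm) :
    HasType k Γ t A := by
  have := h.rename (Δ := Γ) (ρ := id) (by simp)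
  rwa [h.rename_eq _ (by simp), hA.rename_eq _ (by simp)] at this

/-- Typing is stable under strictly monotone maps of universe levels. -/
theorem mapLevels {φ : ℕ → ℕ} (hφ : StrictMono φ) {t A : Tm} (h : HasType k Γ t A) :
    HasType (φ k) (Γ.map (Tm.mapLevels φ)) (t.mapLevels φ) (A.mapLevels φ) := by
  induction h with
  | @var Γ n A hn =>
    rw [mapLevels_rename]
    exact .var (by simp [hn])
  -- Strictness of `φ` is needed here: `univ (φ i)` lies in `univ (φ i + 1)`, and `φ i + 1 ≤ φ (i +
  -- 1)`.
  | univ i => exact (HasType.univ (φ i)).cumul_le (hφ (Nat.lt_succ_self i))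
  | cumul _ ih => exact ih.cumul_le (hφ (Nat.lt_succ_self _)).le
  | const c i j =>
    have h := HasType.const (k := φ k) (Γ := (‹List Tm›).map (Tm.mapLevels φ)) c (φ i) (φ j)
    cases c with
    -- The type `U 0` of these three constants is mapped to `U (φ 0)`, so cumulativity is used; the
    -- types of all other constants are mapped to their instances at the new levels.
    | empty => exact h.cumul_le (Nat.zero_le _)
    | unit => exact h.cumul_le (Nat.zero_le _)
    | nat => exact h.cumul_le (Nat.zero_le _)
    | _ => exact h
  | pi _ _ ihA ihB => exact .pi ihA ihB
  | lam _ _ ihA ihb => exact .lam ihA ihb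
  | app _ _ ihf iha => rw [mapLevels_inst]; exact .app ihf iha
  | conv _ e _ iht ihB => exact .conv iht (e.mapLevels φ) ihB

end HasType

end HoTT

namespace HoTT

open Tm

/-! ### A conversion test -/

namespace Tm

/-- Boolean equality of terms. -/
def beq : Tm → Tm → Bool
  | var n, var m => n == m
  | univ n, univ m => n == m
  | const c, const c' => c == c'
  | pi A B, pi A' B' => beq A A' && beq B B'
  | lam b, lam b' => beq b b'
  | app f a, app f' a' => beq f f' && beq a a'
  | _, _ => false

theorem eq_of_beq {t u : Tm} (h : t.beq u = true) : t = u := by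
  induction t generalizing u with
  | pi A B hA hB =>
    cases u <;> simp only [beq, Bool.and_eq_true, Bool.false_eq_true] at h
    rw [hA h.1, hB h.2]
  | lam b hb =>
    cases u <;> simp only [beq, Bool.false_eq_true] at h
    rw [hb h]
  | app f a hf ha =>
    cases u <;> simp only [beq, Bool.and_eq_true, Bool.false_eq_true] at h
    rw [hf h.1, ha h.2]
  | _ => cases u <;> simp_all [beq]

/-- Renaming of the variables from `c` on by adding `k`. -/
def lift (k : ℕ) : ℕ → Tm → Tm
  | c, var n =>
    match n.blt c with
    | true => var n
    | false => var (n + k)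
  | _, univ i => univ i
  | _, const c => const c
  | c, pi A B => pi (lift k c A) (lift k (c + 1) B)
  | c, lam b => lam (lift k (c + 1) b)
  | c, app f a => app (lift k c f) (lift k c a)

/-- The renaming that underlies `lift`. -/
def liftVar (k c n : ℕ) : ℕ :=
  match n.blt c with
  | true => n
  | false => n + k

theorem up_liftVar (k c : ℕ) : up (liftVar k c) = liftVar k (c + 1) := by
  funext n
  cases n with
  | zero => rfl
  | succ n =>
    have e : (n + 1).blt (c + 1) = n.blt c := rfl
    simp only [up, liftVar, e]
    cases n.blt c
    · exact Nat.add_right_comm n k 1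
    · rfl

theorem lift_eq (k : ℕ) (t : Tm) : ∀ c, t.lift k c = t.rename (liftVar k c) := by
  induction t with
  | var n => intro c; simp only [lift, rename, liftVar]; cases n.blt c <;> rfl
  | pi A B hA hB => intro c; simp only [lift, rename, up_liftVar, hA, hB]
  | lam b hb => intro c; simp only [lift, rename, up_liftVar, hb]
  | app f a hf ha => intro c; simp only [lift, rename, hf, ha]
  | _ => intro c; rfl

/-- Renaming of all variables by adding `k`. -/
def shift (t : Tm) : ℕ → Tm
  | 0 => t
  | k + 1 => t.lift (k + 1) 0

theorem shift_eq (t : Tm) (k : ℕ) : t.shift k = t.rename fun n => n + k := by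
  cases k with
  | zero => exact ((rename_eq_subst _ t).trans (subst_var t)).symm
  | succ k => exact lift_eq (k + 1) t 0

/-- The substitution of a list of terms for the first variables. -/
def env : List Tm → ℕ → Tm
  | [], n => var n
  | a :: _, 0 => a
  | _ :: σ, n + 1 => env σ n

/-- The substitution `env σ` under `d` binders. -/
def envUnder (σ : List Tm) (d n : ℕ) : Tm :=
  match n.blt d with
  | true => var n
  | false => (env σ (n - d)).shift d

theorem ups_envUnder (σ : List Tm) (d : ℕ) : ups (envUnder σ d) = envUnder σ (d + 1) := by
  funext n
  cases n with
  | zero => rfl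
  | succ n =>
    have e : (n + 1).blt (d + 1) = n.blt d := rfl
    simp only [ups, envUnder, e]
    cases n.blt d
    · simp only [shift_eq, rename_rename, Nat.add_sub_add_right]
      rfl
    · rfl

/-- Substitution of a list of terms for the first variables after `d`. -/
def substEnv (σ : List Tm) : ℕ → Tm → Tm
  | d, var n => envUnder σ d n
  | _, univ i => univ i
  | _, const c => const c
  | d, pi A B => pi (substEnv σ d A) (substEnv σ (d + 1) B)
  | d, lam b => lam (substEnv σ (d + 1) b)
  | d, app f a => app (substEnv σ d f) (substEnv σ d a)

theorem substEnv_eq_subst (σ : List Tm) (t : Tm) :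
    ∀ d, substEnv σ d t = t.subst (envUnder σ d) := by
  induction t with
  | pi A B hA hB => intro d; simp only [substEnv, subst, ups_envUnder, hA, hB]
  | lam b hb => intro d; simp only [substEnv, subst, ups_envUnder, hb]
  | app f a hf ha => intro d; simp only [substEnv, subst, hf, ha]
  | _ => intro d; rfl

/-- Substitution of a list of terms for the first variables. -/
def instList (t : Tm) : List Tm → Tm
  | [] => t
  | a :: σ => substEnv (a :: σ) 0 t

theorem instList_eq (t : Tm) (σ : List Tm) : t.instList σ = t.subst (env σ) := by
  cases σ with
  | nil => exact (subst_var t).symm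
  | cons a σ => exact substEnv_eq_subst (a :: σ) t 0

theorem env_cons (a : Tm) (σ : List Tm) : env (a :: σ) = subst (single a) ∘ ups (env σ) := by
  funext n
  cases n with
  | zero => rfl
  | succ n => exact (inst_rename_succ (env σ n) a).symm

/-- This justifies delayed substitution: applying a function of type `(pi A B)` under `σ` to `a`
gives the type `B` under `a :: σ`. -/
theorem instList_cons (t a : Tm) (σ : List Tm) :
    t.instList (a :: σ) = (t.subst (ups (env σ))).inst a := by
  rw [instList_eq, env_cons, inst, subst_subst]

theorem instList_singleton (t a : Tm) : t.instList [a] = t.inst a := by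
  rw [instList_eq, env_cons, ← subst_subst]
  exact congrArg (·.inst a) ((congrArg (subst · t) ups_var).trans (subst_var t))

theorem env_singleton (a : Tm) : env [a] = single a := by
  funext n; cases n <;> rfl

theorem instList_pi (A B : Tm) (σ : List Tm) :
    (Tm.pi A B).instList σ = Tm.pi (A.instList σ) (B.subst (ups (env σ))) := by
  simp only [instList_eq, subst]

/-- Iterated application. -/
def apps : Tm → List Tm → Tm
  | t, [] => t
  | t, a :: as => apps (app t a) as

end Tm

theorem Conv.apps {t u : Tm} (h : Conv t u) (as : List Tm) : Conv (t.apps as) (u.apps as) := by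
  induction as generalizing t u with
  | nil => exact h
  | cons a as ih => exact ih (h.app (.refl a))

/-- One computation step of an eliminator `c` that is applied to a list of arguments, given a
function for weak head normal forms and a conversion test. -/
def iota (w : Tm → List Tm → Tm) (cv : Tm → Tm → Bool) (c : Const) (as : List Tm) :
    Option (Tm × List Tm) :=
  match c, as with
  | .natElim, C :: z :: s :: n :: as' =>
    match w n [] with
    | const .zero => some (z, as')
    | app (const .succ) m => some (s, m :: const .natElim C z s m :: as')
    | _ => none
  | .sumElim, A :: B :: _ :: l :: r :: x :: as =>
    match w x [] with
    | app (app (app (const .inl) A') B') a =>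
      -- The computation rules of `Conv` concern raw terms and require literally the same parameters
      -- in eliminator and constructor, so these are first tested for convertibility.
      if cv A A' && cv B B' then some (l, a :: as) else none
    | app (app (app (const .inr) A') B') b =>
      if cv A A' && cv B B' then some (r, b :: as) else none
    | _ => none
  | .sigElim, A :: B :: _ :: c :: s :: as =>
    match w s [] with
    | app (app (app (app (const .pair) A') B') a) b =>
      if cv A A' && cv B B' then some (c, a :: b :: as) else none
    | _ => none
  | .idElim, A :: _ :: c :: x :: y :: p :: as =>
    match w p [] with
    | app (app (const .refl) A') a =>
      if cv A A' && (cv x a && cv y a) then some (c, a :: as) else none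
    | _ => none
  | .gqElim, V :: E :: _ :: c :: _ :: z :: as =>
    match w z [] with
    | app (app (app (const .vert) V') E') v =>
      if cv V V' && cv E E' then some (c, v :: as) else none
    | _ => none
  | _, _ => none

/-- The comparison of two weak head normal forms, given a conversion test for their parts. -/
def cmp (cv : Tm → Tm → Bool) : Tm → Tm → Bool
  | pi A B, pi A' B' => cv A A' && cv B B'
  | lam b, lam b' => cv b b'
  | lam b, u => cv b (app (u.shift 1) (var 0))
  | t, lam b => cv (app (t.shift 1) (var 0)) b
  | app f a, app f' a' => cv f f' && cv a a'
  | t, u => t.beq u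

/-- One step of the computation of the weak head normal form of `t.apps as`. -/
def whnfStep (w : Tm → List Tm → Tm) (cv : Tm → Tm → Bool) : Tm → List Tm → Tm
  | app f a, as => w f (a :: as)
  | lam b, a :: as => w (b.instList [a]) as
  | const c, as =>
    match iota w cv c as with
    | some (t, as') => w t as'
    | none => (const c).apps as
  | t, as => t.apps as

/-- The weak head normal form and the conversion test, with a bound on the recursion depth. -/
def machine (n : ℕ) : (Tm → List Tm → Tm) × (Tm → Tm → Bool) :=
  n.rec (apps, fun t u => t.beq u) fun _ m =>
    (whnfStep m.1 m.2, fun t u => t.beq u || cmp m.2 (m.1 t []) (m.1 u []))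

section

variable {w : Tm → List Tm → Tm} {cv : Tm → Tm → Bool}

theorem conv_of_iota (hw : ∀ t as, Conv (t.apps as) (w t as))
    (hcv : ∀ t u, cv t u = true → Conv t u) {c : Const} {as as' : List Tm} {t : Tm}
    (h : iota w cv c as = some (t, as')) : Conv ((const c).apps as) (t.apps as') := by
  unfold iota at h
  split at h
  · rename_i C z s n as
    have e := hw n []
    split at h
    · rename_i e'
      cases h
      rw [e'] at e
      exact (((Conv.refl _).app e).trans (.nat_zero _ _ _)).apps _
    · rename_i e'
      cases h
      rw [e'] at e
      exact (((Conv.refl _).app e).trans (.nat_succ _ _ _ _)).apps _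
    · cases h
  · rename_i A B C l r x as
    have e := hw x []
    split at h
    · rename_i e'
      split at h
      · rename_i hc
        simp only [Bool.and_eq_true] at hc
        cases h
        rw [e'] at e
        have e := e.trans ((((Conv.refl _).app (hcv _ _ hc.1).symm).app
          (hcv _ _ hc.2).symm).app (.refl _))
        exact (((Conv.refl _).app e).trans (.sum_inl _ _ _ _ _ _)).apps _
      · cases h
    · rename_i e'
      split at h
      · rename_i hc
        simp only [Bool.and_eq_true] at hc
        cases h
        rw [e'] at e
        have e := e.trans ((((Conv.refl _).app (hcv _ _ hc.1).symm).app
          (hcv _ _ hc.2).symm).app (.refl _))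
        exact (((Conv.refl _).app e).trans (.sum_inr _ _ _ _ _ _)).apps _
      · cases h
    · cases h
  · rename_i A B C c s as
    have e := hw s []
    split at h
    · rename_i e'
      split at h
      · rename_i hc
        simp only [Bool.and_eq_true] at hc
        cases h
        rw [e'] at e
        have e := e.trans (((((Conv.refl _).app (hcv _ _ hc.1).symm).app
          (hcv _ _ hc.2).symm).app (.refl _)).app (.refl _))
        exact (((Conv.refl _).app e).trans (.sig_pair _ _ _ _ _ _)).apps _
      · cases h
    · cases h
  · rename_i A C c x y p as
    have e := hw p []
    split at h
    · rename_i A' a e'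
      split at h
      · rename_i hc
        simp only [Bool.and_eq_true] at hc
        cases h
        rw [e'] at e
        have e := e.trans (((Conv.refl _).app (hcv _ _ hc.1).symm).app (.refl a))
        exact (((((Conv.refl _).app (hcv _ _ hc.2.1)).app (hcv _ _ hc.2.2)).app e).trans
          (.id_refl _ _ _ _)).apps _
      · cases h
    · cases h
  · rename_i V E C c p z as
    have e := hw z []
    split at h
    · rename_i e'
      split at h
      · rename_i hc
        simp only [Bool.and_eq_true] at hc
        cases h
        rw [e'] at e
        have e := e.trans ((((Conv.refl _).app (hcv _ _ hc.1).symm).app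
          (hcv _ _ hc.2).symm).app (.refl _))
        exact (((Conv.refl _).app e).trans (.gq_vert _ _ _ _ _ _)).apps _
      · cases h
    · cases h
  · cases h

theorem conv_of_cmp (hcv : ∀ t u, cv t u = true → Conv t u) {t u : Tm}
    (h : cmp cv t u = true) : Conv t u := by
  unfold cmp at h
  split at h
  · simp only [Bool.and_eq_true] at h
    exact .pi (hcv _ _ h.1) (hcv _ _ h.2)
  · exact .lam (hcv _ _ h)
  · rw [shift_eq] at h
    exact (Conv.lam (hcv _ _ h)).trans (.eta _)
  · rw [shift_eq] at h
    exact (Conv.eta _).symm.trans (Conv.lam (hcv _ _ h))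
  · simp only [Bool.and_eq_true] at h
    exact .app (hcv _ _ h.1) (hcv _ _ h.2)
  · exact eq_of_beq h ▸ .refl _

theorem conv_whnfStep (hw : ∀ t as, Conv (t.apps as) (w t as))
    (hcv : ∀ t u, cv t u = true → Conv t u) (t : Tm) (as : List Tm) :
    Conv (t.apps as) (whnfStep w cv t as) := by
  unfold whnfStep
  split
  · exact hw _ (_ :: _)
  · rw [instList_singleton]
    exact ((Conv.beta _ _).apps _).trans (hw _ _)
  · split
    · rename_i h
      exact (conv_of_iota hw hcv h).trans (hw _ _)
    · exact .refl _
  · exact .refl _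

end

/-- Only positive answers are claimed to be correct. At depth zero no reduction takes place and the
comparison is syntactic, which is sound; hence neither normalization nor confluence enters. -/
theorem conv_machine (n : ℕ) : (∀ t as, Conv (t.apps as) ((machine n).1 t as)) ∧
    ∀ t u, (machine n).2 t u = true → Conv t u := by
  induction n with
  | zero => exact ⟨fun _ _ => .refl _, fun _ _ h => eq_of_beq h ▸ .refl _⟩
  | succ n ih =>
    refine ⟨conv_whnfStep ih.1 ih.2, fun t u h => ?_⟩
    rcases Bool.or_eq_true _ _ ▸ h with h | h
    · exact eq_of_beq h ▸ .refl _
    · exact (ih.1 t []).trans ((conv_of_cmp ih.2 h).trans (ih.1 u []).symm)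

/-- Weak head normal forms. -/
def whnf (t : Tm) : Tm := (machine 1000).1 t []

/-- The conversion test. -/
def conv (t u : Tm) : Bool := (machine 1000).2 t u

theorem conv_whnf (t : Tm) : Conv t (whnf t) := (conv_machine 1000).1 t []

theorem conv_of_conv {t u : Tm} (h : conv t u = true) : Conv t u := (conv_machine 1000).2 t u h

/-! ### A type checker -/

/-- A signature: the primitive constants that may be used, with eliminations into `U 2` and with
parameters in `U 1`, and closed terms with their types. -/
structure Signature : Type where
  /-- the constants -/
  consts : List Const
  /-- the closed terms with their types -/
  defs : List (Tm × Tm)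

/-- The type of the term `t` of a signature. -/
def lookup (t : Tm) : List (Tm × Tm) → Option Tm
  | [] => none
  | (u, A) :: l => if t.beq u then some A else lookup t l

/-- The level of a universe. -/
def sort : Option (Tm × List Tm) → Option ℕ
  | some T =>
    match whnf (T.1.instList T.2) with
    | univ i => some i
    | _ => none
  | none => none

/-- The level of the universe in which a family of types takes its values. -/
def familySort : Option (Tm × List Tm) → Option ℕ
  | some T =>
    match whnf (T.1.instList T.2) with
    | Tm.pi _ (univ i) => some i
    | _ => none
  | none => none

section

variable (S : Signature) (inf : List Tm → Tm → Option (Tm × List Tm))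
  (chk : List Tm → Tm → Tm → Bool)

/-- The type of an application, given the type of the function. Types are given as pairs of a term
and a list of terms that are to be substituted in it. -/
def inferOf (Γ : List Tm) (F : Tm × List Tm) (a : Tm) : Option (Tm × List Tm) :=
  match F with
  -- In an iterated application the arguments pile up in `σ`, and no substitution is carried out in
  -- `B` at this point.
  | (pi A B, σ) =>
    match chk Γ a (A.instList σ) with
    | true => some (B, a :: σ)
    | false => none
  | (F, σ) =>
    match whnf (F.instList σ) with
    | pi A B =>
      -- The conversion rule requires the new type to be well-formed. Subject reduction is not
      -- established, so the weak head normal form is checked afresh.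
      match (sort (inf Γ (pi A B))).isSome && chk Γ a A with
      | true => some (B, [a])
      | false => none
    | _ => none

/-- The type of an application, by inference of the type of the function. -/
def inferGeneral (Γ : List Tm) (f a : Tm) : Option (Tm × List Tm) :=
  match inf Γ f with
  | some F => inferOf inf chk Γ F a
  | none => none

/-- The type of an application. -/
def inferApp (Γ : List Tm) (f a : Tm) : Option (Tm × List Tm) :=
  match f, a with
  -- Type formers get a level computed from their components instead of the fixed level of the
  -- constant; otherwise `trunc` would not stay in `U 0`.
  | app (const .sig) A, lam B =>
    match sort (inf Γ A), sort (inf (A :: Γ) B) with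
    | some i, some j => some (univ (max i j), [])
    | _, _ => none
  | app (const .sig) A, B =>
    match sort (inf Γ A), familySort (inf Γ B) with
    | some i, some j =>
      match i.ble j && chk Γ B (Tm.pi A (univ j)) with
      | true => some (univ j, [])
      | false => none
    | _, _ => none
  | app (const .sum) A, B =>
    match sort (inf Γ A), sort (inf Γ B) with
    | some i, some j => some (univ (max i j), [])
    | _, _ => none
  | app (app (const .id) A) x, y =>
    match sort (inf Γ A) with
    | some i =>
      match chk Γ x A && chk Γ y A with
      | true => some (univ i, [])
      | false => none
    | none => none
  -- The type of an abstraction is inferred only if the signature records it; other redexes are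
  -- typed from the type of the argument.
  | lam b, a =>
    match lookup (lam b) S.defs with
    | some F => inferOf inf chk Γ (F, []) a
    | none =>
      match inf Γ a with
      | some A =>
        match inf (A.1.instList A.2 :: Γ) b with
        | some B => some (B.1.instList B.2, [a])
        | none => none
      | none => none
  -- Edge relations such as `seqEdges X f v w` have this form. The type of `w` is inferred outside
  -- both binders, hence the shift by one.
  | app (lam (lam b)) v, w =>
    match lookup (lam (lam b)) S.defs with
    | some _ => inferGeneral inf chk Γ (app (lam (lam b)) v) w
    | none =>
      match inf Γ v, inf Γ w with
      | some A, some B =>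
        match inf ((B.1.instList B.2).shift 1 :: A.1.instList A.2 :: Γ) b with
        | some C => some (C.1.instList C.2, [w, v])
        | none => none
      | _, _ => none
  | f, a => inferGeneral inf chk Γ f a

/-- One step of type inference. -/
def inferStep (Γ : List Tm) (t : Tm) : Option (Tm × List Tm) :=
  match t with
  | var n =>
    match Γ[n]? with
    | some A => some (A.shift (n + 1), [])
    | none => none
  | univ i => some (univ (i + 1), [])
  | const c =>
    match S.consts.contains c with
    -- Elimination reaches `U 2` because the motive in `pathInd` quantifies over families in `U 1`.
    | true => some ((constType 0 1 2 c).close, [])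
    | false => none
  | pi A B =>
    match sort (inf Γ A), sort (inf (A :: Γ) B) with
    | some i, some j => some (univ (max i j), [])
    | _, _ => none
  | lam b =>
    match lookup (lam b) S.defs with
    | some A => some (A, [])
    | none => none
  | app f a => inferApp S inf chk Γ f a

/-- `A` is a subtype of `C`. -/
def sub (A C : Tm) : Bool :=
  A.beq C ||
    match whnf A, whnf C with
    | univ i, univ j => i.ble j
    | A', C' => cmp conv A' C'

/-- The test of `Γ ⊢ t : C` by inference of the type of `t`. -/
def checkInfer (Γ : List Tm) (t C : Tm) : Bool :=
  match inf Γ t with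
  | some A => sub (A.1.instList A.2) C
  | none => false

/-- One step of type checking. -/
def checkStep (Γ : List Tm) (t C : Tm) : Bool :=
  match t with
  | lam b =>
    match C with
    | pi A B => chk (A :: Γ) b B
    | C =>
      match whnf C with
      | pi A B => (sort (inf Γ (pi A B))).isSome && chk (A :: Γ) b B
      | _ => false
  | app (lam b) a =>
    checkInfer inf Γ (app (lam b) a) C ||
      match inf Γ a with
      | some A => chk (A.1.instList A.2 :: Γ) b (C.shift 1)
      | none => false
  | t => checkInfer inf Γ t C

end

/-- Type inference and type checking, with a bound on the recursion depth. -/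
def checker (S : Signature) (n : ℕ) :
    (List Tm → Tm → Option (Tm × List Tm)) × (List Tm → Tm → Tm → Bool) :=
  n.rec (fun _ _ => none, fun _ _ _ => false) fun _ m =>
    (inferStep S m.1 m.2, checkStep m.1 m.2)

/-- Type inference. -/
def Signature.infer (S : Signature) : List Tm → Tm → Option (Tm × List Tm) := (checker S 1000).1

/-- Type checking. -/
def Signature.check (S : Signature) : List Tm → Tm → Tm → Bool := (checker S 1000).2

/-! ### Soundness of the type checker -/

/-- `A` is a type in the context `Γ`. -/
def IsType (Γ : List Tm) (A : Tm) : Prop := ∃ i, HasType 0 Γ A (univ i)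

/-- `t` is a term of a type `A` in the context `Γ`. -/
def Valid (Γ : List Tm) (t A : Tm) : Prop := HasType 0 Γ t A ∧ IsType Γ A

/-- `t` is a term of a type in the context `Γ` that is given by a substitution. -/
def ValidInst (Γ : List Tm) (t : Tm) (A : Tm × List Tm) : Prop := Valid Γ t (A.1.instList A.2)

/-- All entries of `Γ` are types. -/
def WellFormed (Γ : List Tm) : Prop :=
  ∀ (n : ℕ) (A : Tm), Γ[n]? = some A → IsType Γ (A.rename fun m => m + (n + 1))

/-- All types in the signature are types, and all terms have the given type. -/
structure Signature.Sound (S : Signature) : Prop where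
  consts : ∀ c ∈ S.consts, IsType [] (constType 0 1 2 c).close
  defs : ∀ d ∈ S.defs, Valid [] d.1 d.2

theorem IsType.weaken {Γ : List Tm} {A : Tm} (h : IsType Γ A) (B : Tm) :
    IsType (B :: Γ) (A.rename Nat.succ) :=
  ⟨h.choose, h.choose_spec.weaken B⟩

theorem IsType.univ (Γ : List Tm) (i : ℕ) : IsType Γ (univ i) := ⟨i + 1, .univ i⟩

theorem IsType.of_pi_left {Γ : List Tm} {A B : Tm} (h : IsType Γ (Tm.pi A B)) : IsType Γ A :=
  ⟨_, h.choose_spec.pi_inv.choose_spec.1⟩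

theorem IsType.of_pi_right {Γ : List Tm} {A B : Tm} (h : IsType Γ (Tm.pi A B)) :
    IsType (A :: Γ) B :=
  ⟨_, h.choose_spec.pi_inv.choose_spec.2⟩

theorem IsType.pi {Γ : List Tm} {A B : Tm} (hA : IsType Γ A) (hB : IsType (A :: Γ) B) :
    IsType Γ (Tm.pi A B) := by
  obtain ⟨i, hA⟩ := hA
  obtain ⟨j, hB⟩ := hB
  exact ⟨max i j, .pi (hA.cumul_le (le_max_left _ _)) (hB.cumul_le (le_max_right _ _))⟩

theorem IsType.inst {Γ : List Tm} {A B a : Tm} (h : IsType (A :: Γ) B) (ha : HasType 0 Γ a A) :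
    IsType Γ (B.inst a) :=
  ⟨h.choose, h.choose_spec.inst ha⟩

theorem WellFormed.cons {Γ : List Tm} {A : Tm} (h : WellFormed Γ) (hA : IsType Γ A) :
    WellFormed (A :: Γ) := by
  intro n B hn
  cases n with
  | zero =>
    obtain rfl : A = B := by simpa using hn
    exact hA.weaken A
  | succ n =>
    have := (h n B (by simpa using hn)).weaken A
    rw [rename_rename] at this
    exact this

theorem lookup_sound {t A : Tm} {l : List (Tm × Tm)} (h : lookup t l = some A) : (t, A) ∈ l := by
  induction l with
  | nil => cases h
  | cons d l ih =>
    obtain ⟨u, B⟩ := d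
    unfold lookup at h
    split at h
    · rename_i e
      cases h
      exact eq_of_beq e ▸ List.mem_cons_self
    · exact List.mem_cons_of_mem _ (ih h)

theorem Signature.Sound.valid_lookup {S : Signature} (hS : S.Sound) {Γ : List Tm} {t A : Tm}
    (h : lookup t S.defs = some A) : Valid Γ t A := by
  have hv := hS.defs _ (lookup_sound h)
  exact ⟨hv.1.of_closed hv.2.choose_spec Γ, _, hv.2.choose_spec.of_closed (.univ _) Γ⟩

section

variable {S : Signature} {inf : List Tm → Tm → Option (Tm × List Tm)}
  {chk : List Tm → Tm → Tm → Bool}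
  {Γ : List Tm}

theorem hasType_of_sort {A : Tm} {i : ℕ}
    (hinf : ∀ B, inf Γ A = some B → ValidInst Γ A B) (h : sort (inf Γ A) = some i) :
    HasType 0 Γ A (univ i) := by
  unfold sort at h
  split at h
  · rename_i T e
    split at h
    · rename_i e'
      cases h
      have := conv_whnf (T.1.instList T.2)
      rw [e'] at this
      exact (hinf T e).1.conv this (.univ _)
    · cases h
  · cases h

theorem isType_of_isSome {A : Tm} (hinf : ∀ B, inf Γ A = some B → ValidInst Γ A B)
    (h : (sort (inf Γ A)).isSome = true) : IsType Γ A :=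
  ⟨_, hasType_of_sort hinf (Option.some_get h).symm⟩

theorem valid_app {A B f a : Tm} (hf : Valid Γ f (Tm.pi A B)) (ha : HasType 0 Γ a A) :
    Valid Γ (app f a) (B.inst a) :=
  ⟨.app hf.1 ha, hf.2.of_pi_right.inst ha⟩

theorem valid_beta {A B b a : Tm} (ha : Valid Γ a A) (hb : Valid (A :: Γ) b B) :
    Valid Γ (app (lam b) a) (B.inst a) :=
  ⟨.app (.lam ha.2.choose_spec hb.1) ha.1, hb.2.inst ha.1⟩

/-- The domain of the inner abstraction is a weakened type, so substituting `v` in it gives `B`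
back. -/
theorem valid_beta_beta {A B C b v w : Tm} (hv : Valid Γ v A) (hw : Valid Γ w B)
    (hb : Valid (B.rename Nat.succ :: A :: Γ) b C) :
    Valid Γ (app (app (lam (lam b)) v) w) ((C.subst (ups (single v))).inst w) := by
  have hB := hw.2.weaken A
  have h := valid_beta hv ⟨.lam hB.choose_spec hb.1, hB.pi hb.2⟩
  have e : (Tm.pi (B.rename Nat.succ) C).inst v = Tm.pi B (C.subst (ups (single v))) :=
    congrArg (Tm.pi · _) (inst_rename_succ B v)
  rw [e] at h
  exact valid_app h hw.1

theorem hasType_sig {A B : Tm} {i : ℕ} (hA : HasType 0 Γ A (univ i))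
    (hB : HasType 0 (A :: Γ) B (univ i)) :
    HasType 0 Γ (app (app (const .sig) A) (lam B)) (univ i) :=
  .app (.app (.const .sig i 0) hA) (.lam hA hB)

theorem hasType_sum {A B : Tm} {i : ℕ} (hA : HasType 0 Γ A (univ i))
    (hB : HasType 0 Γ B (univ i)) : HasType 0 Γ (app (app (const .sum) A) B) (univ i) :=
  .app (.app (.const .sum i 0) hA) hB

theorem hasType_id {A x y : Tm} {i : ℕ} (hA : HasType 0 Γ A (univ i)) (hx : HasType 0 Γ x A)
    (hy : HasType 0 Γ y A) : HasType 0 Γ (app (app (app (const .id) A) x) y) (univ i) := by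
  have h := HasType.app (HasType.app (HasType.const .id i 0) hA) hx
  refine HasType.app (A := A) (B := univ i) ?_ hy
  have e : (ups (single A) 1).inst x = A := inst_rename_succ A x
  have h : HasType 0 Γ (app (app (const .id) A) x)
      (Tm.pi ((ups (single A) 1).inst x) (univ i)) := h
  rwa [e] at h

variable (hS : S.Sound)
  (hinf : ∀ Γ t A, WellFormed Γ → inf Γ t = some A → ValidInst Γ t A)
  (hchk : ∀ Γ t A, WellFormed Γ → IsType Γ A → chk Γ t A = true → HasType 0 Γ t A)
  (hΓ : WellFormed Γ)

include hinf hchk hΓ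

theorem inferOf_sound {F : Tm × List Tm} {f a : Tm} {C : Tm × List Tm} (hf : ValidInst Γ f F)
    (h : inferOf inf chk Γ F a = some C) : ValidInst Γ (app f a) C := by
  unfold inferOf at h
  split at h
  · split at h
    · rename_i e
      cases h
      simp only [ValidInst, instList_pi] at hf
      simp only [ValidInst, instList_cons]
      exact valid_app hf (hchk _ _ _ hΓ hf.2.of_pi_left e)
    · cases h
  · split at h
    · rename_i F σ _ _ _ _ e
      split at h
      · rename_i e'
        cases h
        simp only [Bool.and_eq_true] at e'
        have ht := isType_of_isSome (fun B => hinf _ _ B hΓ) e'.1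
        have hc := conv_whnf (F.instList σ)
        rw [e] at hc
        simp only [ValidInst, instList_singleton]
        exact valid_app ⟨hf.1.conv hc ht.choose_spec, ht⟩ (hchk _ _ _ hΓ ht.of_pi_left e'.2)
      · cases h
    · cases h

theorem inferGeneral_sound {f a : Tm} {C : Tm × List Tm}
    (h : inferGeneral inf chk Γ f a = some C) : ValidInst Γ (app f a) C := by
  unfold inferGeneral at h
  split at h
  · rename_i e
    exact inferOf_sound hinf hchk hΓ (hinf _ _ _ hΓ e) h
  · cases h

include hS

theorem inferApp_sound {f a : Tm} {C : Tm × List Tm} (h : inferApp S inf chk Γ f a = some C) :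
    ValidInst Γ (app f a) C := by
  unfold inferApp at h
  split at h
  · split at h
    · rename_i e e'
      cases h
      have hA := hasType_of_sort (fun B => hinf _ _ B hΓ) e
      have hB := hasType_of_sort (fun B => hinf _ _ B (hΓ.cons ⟨_, hA⟩)) e'
      exact ⟨hasType_sig (hA.cumul_le (le_max_left _ _)) (hB.cumul_le (le_max_right _ _)),
        .univ _ _⟩
    · cases h
  · split at h
    · rename_i e e'
      split at h
      · rename_i e''
        cases h
        simp only [Bool.and_eq_true] at e''
        have hA := (hasType_of_sort (fun B => hinf _ _ B hΓ) e).cumul_le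
          (Nat.le_of_ble_eq_true e''.1)
        have hB := hchk _ _ _ hΓ (.pi ⟨_, hA⟩ (.univ _ _)) e''.2
        exact ⟨.app (.app (.const .sig _ 0) hA) hB, .univ _ _⟩
      · cases h
    · cases h
  · split at h
    · rename_i e e'
      cases h
      have hA := hasType_of_sort (fun B => hinf _ _ B hΓ) e
      have hB := hasType_of_sort (fun B => hinf _ _ B hΓ) e'
      exact ⟨hasType_sum (hA.cumul_le (le_max_left _ _)) (hB.cumul_le (le_max_right _ _)),
        .univ _ _⟩
    · cases h
  · split at h
    · rename_i e
      split at h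
      · rename_i e'
        cases h
        simp only [Bool.and_eq_true] at e'
        have hA := hasType_of_sort (fun B => hinf _ _ B hΓ) e
        exact ⟨hasType_id hA (hchk _ _ _ hΓ ⟨_, hA⟩ e'.1) (hchk _ _ _ hΓ ⟨_, hA⟩ e'.2),
          .univ _ _⟩
      · cases h
    · cases h
  · split at h
    · rename_i e
      exact inferOf_sound hinf hchk hΓ (F := (_, [])) (hS.valid_lookup e) h
    · split at h
      · rename_i e
        split at h
        · rename_i e'
          cases h
          have ha := hinf _ _ _ hΓ e
          simp only [ValidInst, instList_singleton]
          exact valid_beta ha (hinf _ _ _ (hΓ.cons ha.2) e')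
        · cases h
      · cases h
  · split at h
    · exact inferGeneral_sound hinf hchk hΓ h
    · split at h
      · rename_i e e'
        split at h
        · rename_i e''
          cases h
          have hv := hinf _ _ _ hΓ e
          have hw := hinf _ _ _ hΓ e'
          rw [shift_eq] at e''
          simp only [ValidInst, instList_cons, env_singleton]
          exact valid_beta_beta hv hw
            (hinf _ _ _ ((hΓ.cons hv.2).cons (hw.2.weaken _)) e'')
        · cases h
      · cases h
  · exact inferGeneral_sound hinf hchk hΓ h

theorem inferStep_sound {t : Tm} {C : Tm × List Tm} (h : inferStep S inf chk Γ t = some C) :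
    ValidInst Γ t C := by
  unfold inferStep at h
  split at h
  · split at h
    · rename_i e
      cases h
      simp only [ValidInst, instList, shift_eq]
      exact ⟨.var e, hΓ _ _ e⟩
    · cases h
  · cases h
    exact ⟨.univ _, .univ _ _⟩
  · split at h
    · rename_i e
      cases h
      have hc := hS.consts _ (by simpa using e)
      exact ⟨.const _ 1 2, _, hc.choose_spec.of_closed (.univ _) Γ⟩
    · cases h
  · split at h
    · rename_i e e'
      cases h
      have hA := hasType_of_sort (fun B => hinf _ _ B hΓ) e
      have hB := hasType_of_sort (fun B => hinf _ _ B (hΓ.cons ⟨_, hA⟩)) e'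
      exact ⟨.pi (hA.cumul_le (le_max_left _ _)) (hB.cumul_le (le_max_right _ _)), .univ _ _⟩
    · cases h
  · split at h
    · rename_i e
      cases h
      exact hS.valid_lookup e
    · cases h
  · exact inferApp_sound hS hinf hchk hΓ h

omit hS hchk in
theorem checkInfer_sound {t C : Tm} (hC : IsType Γ C) (h : checkInfer inf Γ t C = true) :
    HasType 0 Γ t C := by
  unfold checkInfer at h
  split at h
  · rename_i A e
    have ht := (hinf _ _ _ hΓ e).1
    have hA := conv_whnf (A.1.instList A.2)
    have hC' := conv_whnf C
    rcases Bool.or_eq_true _ _ ▸ h with h | h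
    · exact eq_of_beq h ▸ ht
    · split at h
      · rename_i e e'
        rw [e] at hA
        rw [e'] at hC'
        exact ((ht.conv hA (.univ _)).cumul_le (Nat.le_of_ble_eq_true h)).conv hC'.symm
          hC.choose_spec
      · exact ht.conv (hA.trans ((conv_of_cmp (fun _ _ => conv_of_conv) h).trans hC'.symm))
          hC.choose_spec
  · cases h

omit hS in
theorem checkStep_sound {t C : Tm} (hC : IsType Γ C) (h : checkStep inf chk Γ t C = true) :
    HasType 0 Γ t C := by
  unfold checkStep at h
  split at h
  · split at h
    · exact .lam hC.of_pi_left.choose_spec (hchk _ _ _ (hΓ.cons hC.of_pi_left) hC.of_pi_right h)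
    · split at h
      · rename_i e
        simp only [Bool.and_eq_true] at h
        have ht := isType_of_isSome (fun B => hinf _ _ B hΓ) h.1
        have hc := conv_whnf C
        rw [e] at hc
        exact HasType.conv (.lam ht.of_pi_left.choose_spec
          (hchk _ _ _ (hΓ.cons ht.of_pi_left) ht.of_pi_right h.2)) hc.symm hC.choose_spec
      · cases h
  · rcases Bool.or_eq_true _ _ ▸ h with h | h
    · exact checkInfer_sound hinf hΓ hC h
    · split at h
      · rename_i A e
        have ha := hinf _ _ _ hΓ e
        rw [shift_eq] at h
        have hb := hchk _ _ _ (hΓ.cons ha.2) (hC.weaken _) h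
        have := HasType.app (.lam ha.2.choose_spec hb) ha.1
        rwa [inst_rename_succ] at this
      · cases h
  · exact checkInfer_sound hinf hΓ hC h

end

/-- At depth zero everything is rejected, and each step is sound relative to an arbitrary sound pair
of inference and checking functions. -/
theorem checker_sound {S : Signature} (hS : S.Sound) (n : ℕ) :
    (∀ Γ t A, WellFormed Γ → (checker S n).1 Γ t = some A → ValidInst Γ t A) ∧
    ∀ Γ t A, WellFormed Γ → IsType Γ A → (checker S n).2 Γ t A = true → HasType 0 Γ t A := by
  induction n with
  | zero => exact ⟨fun _ _ _ _ h => (nomatch h), fun _ _ _ _ _ h => (nomatch h)⟩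
  | succ n ih =>
    exact ⟨fun _ _ _ hΓ h => inferStep_sound hS ih.1 ih.2 hΓ h,
      fun _ _ _ hΓ hA h => checkStep_sound ih.1 ih.2 hΓ hA h⟩

theorem wellFormed_nil : WellFormed [] := fun n A h => by simp at h

namespace Signature

/-- The test whether `A` is a type. -/
def isType (S : Signature) (Γ : List Tm) (A : Tm) : Bool := (sort (S.infer Γ A)).isSome

/-- The test whether `C` is the inferred type of `t`. -/
def infers (S : Signature) (Γ : List Tm) (t C : Tm) : Bool :=
  match S.infer Γ t with
  | some A => (A.1.instList A.2).beq C
  | none => false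

/-- The test whether `C` is a type and `t` is a term of this type. -/
def accepts (S : Signature) (Γ : List Tm) (t C : Tm) : Bool :=
  match t, C with
  | lam b, Tm.pi A B => S.isType Γ A && S.accepts (A :: Γ) b B
  | t, C => S.infers Γ t C || (S.isType Γ C && S.check Γ t C)

/-- The signature extended by a closed term and its type. -/
def extend (S : Signature) (t A : Exp) : Signature := ⟨S.consts, (t.close, A.close) :: S.defs⟩

variable {S : Signature}

theorem Sound.isType (hS : S.Sound) {Γ : List Tm} (hΓ : WellFormed Γ) {A : Tm}
    (h : S.isType Γ A = true) : IsType Γ A :=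
  isType_of_isSome (fun B => (checker_sound hS 1000).1 _ _ B hΓ) h

theorem Sound.infers (hS : S.Sound) {Γ : List Tm} (hΓ : WellFormed Γ) {t C : Tm}
    (h : S.infers Γ t C = true) : Valid Γ t C := by
  unfold Signature.infers at h
  split at h
  · rename_i e
    exact eq_of_beq h ▸ (checker_sound hS 1000).1 _ _ _ hΓ e
  · cases h

theorem Sound.accepts (hS : S.Sound) {t : Tm} : ∀ {Γ : List Tm} {C : Tm}, WellFormed Γ →
    S.accepts Γ t C = true → Valid Γ t C := by
  have hc {Γ : List Tm} {t C : Tm} (hΓ : WellFormed Γ)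
      (h : (S.infers Γ t C || (S.isType Γ C && S.check Γ t C)) = true) : Valid Γ t C := by
    rcases Bool.or_eq_true _ _ ▸ h with h | h
    · exact hS.infers hΓ h
    · simp only [Bool.and_eq_true] at h
      have hC := hS.isType hΓ h.1
      exact ⟨(checker_sound hS 1000).2 _ _ _ hΓ hC h.2, hC⟩
  induction t with
  | lam b hb =>
    intro Γ C hΓ h
    unfold Signature.accepts at h
    split at h
    · rename_i e
      cases e
      simp only [Bool.and_eq_true] at h
      have hA := hS.isType hΓ h.1
      have hb := hb (hΓ.cons hA) h.2
      exact ⟨.lam hA.choose_spec hb.1, hA.pi hb.2⟩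
    · exact hc hΓ h
  | _ => exact hc

/-- Inference afterwards reads off the recorded type of `t`, whereas the conversion test can still
compute with its body. -/
theorem Sound.extend (hS : S.Sound) {t A : Exp} (h : S.accepts [] t.close A.close = true) :
    (S.extend t A).Sound :=
  ⟨hS.consts, by
    intro d hd
    rcases List.mem_cons.1 hd with rfl | hd
    · exact hS.accepts wellFormed_nil h
    · exact hS.defs d hd⟩

/-- The test whether the types of constants are types, where each of them may use the constants
that come later in the list. -/
def acceptsConsts : List Const → Bool
  | [] => true
  | c :: l => acceptsConsts l && (⟨l, []⟩ : Signature).isType [] (constType 0 1 2 c).close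

/-- The list runs against the order of dependence, so the sound tail is what the head is checked
with. -/
theorem sound_of_acceptsConsts {l : List Const} (h : acceptsConsts l = true) :
    (⟨l, []⟩ : Signature).Sound := by
  induction l with
  | nil => exact ⟨by simp, by simp⟩
  | cons c l ih =>
    obtain ⟨h, h'⟩ := Bool.and_eq_true_iff.1 h
    refine ⟨fun c' hc => ?_, by simp⟩
    rcases List.mem_cons.1 hc with e | hc
    · exact e ▸ (ih h).isType wellFormed_nil h'
    · exact (ih h).consts c' hc

/-- The primitive constants of type theory with function extensionality and graph quotients. -/
def base : Signature :=
  -- The formers `sig`, `sum` and `id` are not listed since `inferApp` types them directly.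
  ⟨[.funext, .gqElim, .edge, .vert, .gq, .idElim, .refl, .sigElim, .pair, .sumElim, .inr, .inl,
    .natElim, .succ, .zero, .nat, .emptyElim, .empty], []⟩

theorem base_sound : base.Sound := sound_of_acceptsConsts (by decide +kernel)

end Signature

end HoTT

namespace HoTT

namespace Exp

/-- A closed expression, to be used under binders. -/
def closed (t : Exp) : Exp := ⟨fun _ => t.close⟩

/-- Transport of `v : P y` backwards along `p : x =_A y`. -/
def transportBack (A : Exp) (P : Exp → Exp) (x y p v : Exp) : Exp :=
  cst .idElim A (lam fun x => lam fun y => lam fun _ => arr (P y) (P x))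
    (lam fun _ => lam fun v => v) x y p v

end Exp

open Exp

/-! ### Identity types -/

/-- Transport forwards and backwards is the identity. -/
def backForth : Exp :=
  lam fun A => lam fun P => lam fun x => lam fun y => lam fun p =>
    cst .idElim A
      (lam fun x => lam fun y => lam fun p => pi (P x) fun u =>
        eq (P x) u (transportBack A (fun z => P z) x y p (transport A (fun z => P z) x y p u)))
      (lam fun x => lam fun u => refl (P x) u) x y p

/-- The type of `backForth`. -/
def backForthType : Exp :=
  pi (U 1) fun A => pi (arr A (U 1)) fun P => pi A fun x => pi A fun y => pi (eq A x y) fun p =>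
    pi (P x) fun u =>
      eq (P x) u (transportBack A (fun z => P z) x y p (transport A (fun z => P z) x y p u))

/-- Transport backwards and forwards is the identity, composed with an identification. -/
def forthBack : Exp :=
  lam fun A => lam fun P => lam fun x => lam fun y => lam fun p =>
    cst .idElim A
      -- Building in `v = v'` saves a separate composition of paths: at reflexivity both transports
      -- compute away and the given identification remains.
      (lam fun x => lam fun y => lam fun p => pi (P y) fun v => pi (P y) fun v' =>
        arr (eq (P y) v v') (eq (P y)
          (transport A (fun z => P z) x y p (transportBack A (fun z => P z) x y p v)) v'))
      (lam fun _ => lam fun _ => lam fun _ => lam fun e => e) x y p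

/-- The type of `forthBack`. -/
def forthBackType : Exp :=
  pi (U 1) fun A => pi (arr A (U 1)) fun P => pi A fun x => pi A fun y => pi (eq A x y) fun p =>
    pi (P y) fun v => pi (P y) fun v' => arr (eq (P y) v v') (eq (P y)
      (transport A (fun z => P z) x y p (transportBack A (fun z => P z) x y p v)) v')

/-- Sections are preserved by transport. -/
def transportSection : Exp :=
  lam fun A => lam fun P => lam fun g => lam fun x => lam fun y => lam fun p =>
    cst .idElim A
      (lam fun x => lam fun y => lam fun p => pi (P x) fun u =>
        arr (eq (P x) u (g x)) (eq (P y) (transport A (fun z => P z) x y p u) (g y)))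
      (lam fun _ => lam fun _ => lam fun e => e) x y p

/-- The type of `transportSection`. -/
def transportSectionType : Exp :=
  pi (U 1) fun A => pi (arr A (U 1)) fun P => pi (pi A fun x => P x) fun g =>
    pi A fun x => pi A fun y => pi (eq A x y) fun p => pi (P x) fun u =>
      arr (eq (P x) u (g x)) (eq (P y) (transport A (fun z => P z) x y p u) (g y))

/-- `u : P x` transported along `p : x = i b'`, backwards and forwards along `r : b = b'`, and
backwards along `p`. -/
def roundTrip (A P B i b b' r x p u : Exp) : Exp :=
  transportBack A (fun z => P z) x (i b') p
    (transport B (fun z => P (i z)) b b' r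
      (transportBack B (fun z => P (i z)) b b' r (transport A (fun z => P z) x (i b') p u)))

/-- The round trip is the identity. -/
def roundTripId : Exp :=
  lam fun A => lam fun P => lam fun B => lam fun i => lam fun b => lam fun b' => lam fun r =>
    cst .idElim B
      (lam fun b => lam fun b' => lam fun r => pi A fun x => pi (eq A x (i b')) fun p =>
        pi (P x) fun u => eq (P x) u (roundTrip A P B i b b' r x p u))
      -- Only `r` is eliminated. The inner pair of transports then disappears, and the outer pair
      -- along `p` is an instance of `backForth`.
      (lam fun b => lam fun x => closed backForth A P x (i b)) b b' r

/-- The type of `roundTripId`. -/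
def roundTripIdType : Exp :=
  pi (U 1) fun A => pi (arr A (U 1)) fun P => pi (U 1) fun B => pi (arr B A) fun i =>
    pi B fun b => pi B fun b' => pi (eq B b b') fun r =>
      pi A fun x => pi (eq A x (i b')) fun p =>
        pi (P x) fun u => eq (P x) u (roundTrip A P B i b b' r x p u)

/-- Based path induction. -/
def pathInd : Exp :=
  lam fun A => lam fun a => lam fun D => lam fun d => lam fun b => lam fun p =>
    cst .idElim A
      (lam fun a => lam fun b => lam fun p =>
        -- The eliminator varies both end points, so the family based at `a` has to be generalized
        -- inside the motive.
        pi (pi A fun x => arr (eq A a x) (U 1)) fun D => arr (D a (refl A a)) (D b p))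
      (lam fun _ => lam fun _ => lam fun d => d) a b p D d

/-- The type of `pathInd`. -/
def pathIndType : Exp :=
  pi (U 1) fun A => pi A fun a => pi (pi A fun x => arr (eq A a x) (U 1)) fun D =>
    arr (D a (refl A a)) (pi A fun b => pi (eq A a b) fun p => D b p)

namespace Signature

/-- The signature with the lemmas on identity types. -/
def paths : Signature :=
  ((((base.extend backForth backForthType).extend forthBack forthBackType).extend
    transportSection transportSectionType).extend roundTripId roundTripIdType).extend
    pathInd pathIndType

theorem paths_sound : paths.Sound :=
  ((((base_sound.extend (by decide +kernel)).extend (by decide +kernel)).extend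
    (by decide +kernel)).extend (by decide +kernel)).extend (by decide +kernel)

end Signature

end HoTT

namespace HoTT

open Exp

/-! ### Sequential colimits of null-homotopic maps -/

namespace Exp

/-- Elements of a family `P` over a cocone `T` at the images of the points `pt n`, given such an
element `b` at `pt 0` and homotopies `H n x : pt n = f n x`. -/
def seqBase (X f T i G pt H P b n : Exp) : Exp :=
  cst .natElim (lam fun n => P (i (succ n) (pt n))) b
    (lam fun n => lam fun u =>
      -- The gluing path leads to the image of the old base point in the next stage; the null
      -- homotopy, read backwards, leads from there to the new base point.
      transportBack (X (succ (succ n))) (fun y => P (i (succ (succ n)) y))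
        (pt (succ n)) (f (succ n) (pt n)) (H (succ n) (pt n))
        (transport T (fun z => P z) (i (succ n) (pt n))
          (i (succ (succ n)) (f (succ n) (pt n))) (G (succ n) (pt n)) u))
    n

/-- Elements of a family `P` over a cocone `T` at the images of all points of the stages. -/
def seqPoint (X f T i G pt H P b n x : Exp) : Exp :=
  transportBack T (fun z => P z) (i n x) (i (succ n) (f n x)) (G n x)
    (transport (X (succ n)) (fun y => P (i (succ n) y)) (pt n) (f n x) (H n x)
      (seqBase X f T i G pt H P b n))

/-- Functions of a cocone `T` of a type sequence with null-homotopic maps, a family of types over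
it, and an element of the family at the image of the first base point. -/
def nullSeqPi (C : Exp → Exp → Exp → Exp → Exp → Exp → Exp → Exp → Exp → Exp) : Exp :=
  pi (arr nat (U 0)) fun X => pi (pi nat fun n => arr (X n) (X (succ n))) fun f =>
    pi (U 0) fun T => pi (pi nat fun n => arr (X n) T) fun i =>
      pi (pi nat fun n => pi (X n) fun x => eq T (i n x) (i (succ n) (f n x))) fun G =>
        pi (pi nat fun n => X (succ n)) fun pt =>
          pi (pi nat fun n => pi (X n) fun x => eq (X (succ n)) (pt n) (f n x)) fun H =>
            pi (arr T (U 1)) fun P => pi (P (i (succ zero) (pt zero))) fun b =>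
              C X f T i G pt H P b

/-- The abstraction that corresponds to `nullSeqPi`. -/
def nullSeqLam (c : Exp → Exp → Exp → Exp → Exp → Exp → Exp → Exp → Exp → Exp) : Exp :=
  lam fun X => lam fun f => lam fun T => lam fun i => lam fun G => lam fun pt => lam fun H =>
    lam fun P => lam fun b => c X f T i G pt H P b

/-- The compatibility of the elements `h n x` of a family `P` over a cocone `T` with the maps of
the sequence. -/
def seqCompatible (X f T i G P h : Exp) : Exp :=
  pi nat fun n => pi (X n) fun x =>
    eq (P (i (succ n) (f n x)))
      (transport T (fun z => P z) (i n x) (i (succ n) (f n x)) (G n x) (h n x))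
      (h (succ n) (f n x))

end Exp

/-- The elements `seqPoint` are compatible with the maps of the sequence. -/
def seqCoherence : Exp :=
  nullSeqLam fun X f T i G pt H P b => lam fun n => lam fun x =>
    -- Forward and backward transport along `G n x` cancel. It remains to see that moving the base
    -- element along `H n x` gives the value of `seqPoint` at `f n x`; as `seqPoint` is a section
    -- over the stage `n + 1`, this need only be known at `pt n`.
    closed forthBack T P (i n x) (i (succ n) (f n x)) (G n x)
      (transport (X (succ n)) (fun y => P (i (succ n) y)) (pt n) (f n x) (H n x)
        (seqBase X f T i G pt H P b n))
      (seqPoint X f T i G pt H P b (succ n) (f n x))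
      (closed transportSection (X (succ n)) (lam fun y => P (i (succ n) y))
        (lam fun y => seqPoint X f T i G pt H P b (succ n) y) (pt n) (f n x) (H n x)
        (seqBase X f T i G pt H P b n)
        -- At `pt n` the value of `seqPoint` unfolds, by the recursion for `seqBase`, to a round
        -- trip along `G` and `H` starting from the base element.
        (closed roundTripId T P (X (succ (succ n))) (i (succ (succ n)))
          (pt (succ n)) (f (succ n) (pt n)) (H (succ n) (pt n)) (i (succ n) (pt n))
          (G (succ n) (pt n)) (seqBase X f T i G pt H P b n)))

/-- The type of `seqCoherence`. -/
def seqCoherenceType : Exp :=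
  nullSeqPi fun X f T i G pt H P b =>
    pi nat fun n => pi (X n) fun x =>
      eq (P (i (succ n) (f n x)))
        (transport T (fun z => P z) (i n x) (i (succ n) (f n x)) (G n x)
          (seqPoint X f T i G pt H P b n x))
        (seqPoint X f T i G pt H P b (succ n) (f n x))

/-- The signature up to `seqCoherence`. -/
def Signature.withSeqCoherence : Signature := paths.extend seqCoherence seqCoherenceType

set_option maxHeartbeats 0 in
theorem Signature.withSeqCoherence_sound : withSeqCoherence.Sound :=
  paths_sound.extend (by decide +kernel)

namespace Exp

/-- The condition that `y` is the image of `x` in the next stage along `p : n + 1 = m`. -/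
def seqNext (X f n x m y p : Exp) : Exp :=
  eq (X m) (transport nat (fun n => X n) (succ n) m p (f n x)) y

/-- The edge from `(n, x)` to `(m, y)` that is given by `p` and `r`. -/
def seqEdge (X f n x m y p r : Exp) : Exp :=
  pair (eq nat (succ n) m) (fun p => seqNext X f n x m y p) p r

/-- The pair `(n, x)`. -/
def seqVertex (X n x : Exp) : Exp := pair nat (fun n => X n) n x

/-- A section of the family `P` over the vertices of the graph of a type sequence. -/
def seqSection (X vt P h v : Exp) : Exp :=
  cst .sigElim nat (lam fun n => X n) (lam fun v => P (vt v)) (lam fun n => lam fun x => h n x) v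

/-- The coherence of `seqSection` over an edge. -/
def seqOverEdge (X T vt ed P h v w e : Exp) : Exp :=
  eq (P (vt w)) (transport T (fun z => P z) (vt v) (vt w) (ed v w e) (seqSection X vt P h v))
    (seqSection X vt P h w)

/-- Functions of data that resemble those of the colimit of a type sequence, and of compatible
elements of a family over the images of the points of the stages. -/
def seqGraphPi (C : Exp → Exp → Exp → Exp → Exp → Exp → Exp → Exp → Exp) : Exp :=
  pi (arr nat (U 0)) fun X => pi (pi nat fun n => arr (X n) (X (succ n))) fun f =>
    pi (U 0) fun T => pi (arr (seqVertices X) T) fun vt =>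
      pi (pi (seqVertices X) fun v => pi (seqVertices X) fun w =>
        arr (seqEdges X f v w) (eq T (vt v) (vt w))) fun ed =>
        pi (arr T (U 1)) fun P =>
          pi (pi nat fun n => pi (X n) fun x => P (vt (seqVertex X n x))) fun h =>
            pi (pi nat fun n => pi (X n) fun x =>
              seqOverEdge X T vt ed P h (seqVertex X n x) (seqVertex X (succ n) (f n x))
                (seqEdge X f n x (succ n) (f n x) (refl nat (succ n))
                  (refl (X (succ n)) (f n x)))) fun c => C X f T vt ed P h c

/-- The abstraction that corresponds to `seqGraphPi`. -/
def seqGraphLam (c : Exp → Exp → Exp → Exp → Exp → Exp → Exp → Exp → Exp) : Exp :=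
  lam fun X => lam fun f => lam fun T => lam fun vt => lam fun ed => lam fun P => lam fun h =>
    lam fun d => c X f T vt ed P h d

end Exp

/-- The coherence of `seqSection` over all edges, in terms of their components. -/
def seqEdgeInd : Exp :=
  seqGraphLam fun X f T vt ed P h c => lam fun n => lam fun x => lam fun m => lam fun p =>
    -- Path induction on `p` and then on `r` reduces every edge to the canonical one from `(n, x)`
    -- to `(n + 1, f n x)`, which `c` handles.
    closed pathInd nat (succ n)
      (lam fun m => lam fun p => pi (X m) fun y => pi (seqNext X f n x m y p) fun r =>
        seqOverEdge X T vt ed P h (seqVertex X n x) (seqVertex X m y) (seqEdge X f n x m y p r))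
      (closed pathInd (X (succ n)) (f n x)
        (lam fun y => lam fun r =>
          seqOverEdge X T vt ed P h (seqVertex X n x) (seqVertex X (succ n) y)
            (seqEdge X f n x (succ n) y (refl nat (succ n)) r))
        (c n x)) m p

/-- The type of `seqEdgeInd`. -/
def seqEdgeIndType : Exp :=
  seqGraphPi fun X f T vt ed P h _ => pi nat fun n => pi (X n) fun x => pi nat fun m =>
    pi (eq nat (succ n) m) fun p => pi (X m) fun y => pi (seqNext X f n x m y p) fun r =>
      seqOverEdge X T vt ed P h (seqVertex X n x) (seqVertex X m y) (seqEdge X f n x m y p r)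

/-- The signature up to `seqEdgeInd`. -/
def Signature.withSeqEdgeInd : Signature := withSeqCoherence.extend seqEdgeInd seqEdgeIndType

set_option maxHeartbeats 0 in
theorem Signature.withSeqEdgeInd_sound : withSeqEdgeInd.Sound :=
  withSeqCoherence_sound.extend (by decide +kernel)

/-- The coherence of `seqSection` over all edges. -/
def seqPathData : Exp :=
  -- Pairs have no `η` rule, so both vertices and the edge are split; on pairs the projections
  -- inside `seqEdges` compute.
  seqGraphLam fun X f T vt ed P h c => lam fun v => cst .sigElim nat (lam fun n => X n)
    (lam fun v => pi (seqVertices X) fun w => pi (seqEdges X f v w) fun e =>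
      seqOverEdge X T vt ed P h v w e)
    (lam fun n => lam fun x => lam fun w => cst .sigElim nat (lam fun n => X n)
      (lam fun w => pi (seqEdges X f (seqVertex X n x) w) fun e =>
        seqOverEdge X T vt ed P h (seqVertex X n x) w e)
      (lam fun m => lam fun y => lam fun e =>
        cst .sigElim (eq nat (succ n) m) (lam fun p => seqNext X f n x m y p)
          (lam fun e => seqOverEdge X T vt ed P h (seqVertex X n x) (seqVertex X m y) e)
          (lam fun p => lam fun r => closed seqEdgeInd X f T vt ed P h c n x m p y r) e)
      w) v

/-- The type of `seqPathData`. -/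
def seqPathDataType : Exp :=
  seqGraphPi fun X f T vt ed P h _ => pi (seqVertices X) fun v => pi (seqVertices X) fun w =>
    pi (seqEdges X f v w) fun e => seqOverEdge X T vt ed P h v w e

/-- The signature up to `seqPathData`. -/
def Signature.withSeqPathData : Signature := withSeqEdgeInd.extend seqPathData seqPathDataType

set_option maxHeartbeats 0 in
theorem Signature.withSeqPathData_sound : withSeqPathData.Sound :=
  withSeqEdgeInd_sound.extend (by decide +kernel)

/-- The structure maps of the sequential colimit. -/
def seqColimIn : Exp := lam fun X => lam fun f => lam fun n => lam fun x => seqIn X f n x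

/-- The type of `seqColimIn`. -/
def seqColimInType : Exp :=
  pi (arr nat (U 0)) fun X => pi (pi nat fun n => arr (X n) (X (succ n))) fun f =>
    pi nat fun n => arr (X n) (seqColim X f)

/-- The signature up to `seqColimIn`. -/
def Signature.withSeqColimIn : Signature := withSeqPathData.extend seqColimIn seqColimInType

set_option maxHeartbeats 0 in
theorem Signature.withSeqColimIn_sound : withSeqColimIn.Sound :=
  withSeqPathData_sound.extend (by decide +kernel)

/-- The paths from the points of a stage to their images in the next stage. -/
def seqGlue : Exp :=
  lam fun X => lam fun f => lam fun n => lam fun x =>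
    edge (seqVertices X) (seqEdges X f) (seqVertex X n x) (seqVertex X (succ n) (f n x))
      (seqEdge X f n x (succ n) (f n x) (refl nat (succ n)) (refl (X (succ n)) (f n x)))

/-- The type of `seqGlue`. -/
def seqGlueType : Exp :=
  pi (arr nat (U 0)) fun X => pi (pi nat fun n => arr (X n) (X (succ n))) fun f =>
    pi nat fun n => pi (X n) fun x =>
      eq (seqColim X f) (seqIn X f n x) (seqIn X f (succ n) (f n x))

/-- The signature up to `seqGlue`. -/
def Signature.withSeqGlue : Signature := withSeqColimIn.extend seqGlue seqGlueType

set_option maxHeartbeats 0 in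
theorem Signature.withSeqGlue_sound : withSeqGlue.Sound :=
  withSeqColimIn_sound.extend (by decide +kernel)

/-- The induction principle of the sequential colimit. -/
def seqColimInd : Exp :=
  lam fun X => lam fun f => lam fun P => lam fun h => lam fun c =>
    cst .gqElim (seqVertices X) (seqEdges X f) (lam fun z => P z)
      (lam fun v => seqSection X (cst .vert (seqVertices X) (seqEdges X f)) P h v)
      -- The abstract cocone is now the colimit itself. The hypothesis `c` fits because `seqSection`
      -- computes on pairs and `seqColimIn` and `seqGlue` unfold to the constructors.
      (closed seqPathData X f (seqColim X f) (cst .vert (seqVertices X) (seqEdges X f))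
        (cst .edge (seqVertices X) (seqEdges X f)) P h c)

/-- The type of `seqColimInd`. -/
def seqColimIndType : Exp :=
  pi (arr nat (U 0)) fun X => pi (pi nat fun n => arr (X n) (X (succ n))) fun f =>
    pi (arr (seqColim X f) (U 1)) fun P =>
      pi (pi nat fun n => pi (X n) fun x => P (seqIn X f n x)) fun h =>
        arr (seqCompatible X f (seqColim X f) (closed seqColimIn X f) (closed seqGlue X f) P h)
          (pi (seqColim X f) fun z => P z)

/-- The signature up to `seqColimInd`. -/
def Signature.withSeqColimInd : Signature := withSeqGlue.extend seqColimInd seqColimIndType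

set_option maxHeartbeats 0 in
theorem Signature.withSeqColimInd_sound : withSeqColimInd.Sound :=
  withSeqGlue_sound.extend (by decide +kernel)

/-- A family over the colimit of a sequence of null-homotopic maps has a section if it has an
element at the first base point. -/
def nullSeqInd : Exp :=
  lam fun X => lam fun f => lam fun pt => lam fun H => lam fun P => lam fun b =>
    closed seqColimInd X f P
      (lam fun n => lam fun x =>
        seqPoint X f (seqColim X f) (closed seqColimIn X f) (closed seqGlue X f) pt H P b n x)
      (closed seqCoherence X f (seqColim X f) (closed seqColimIn X f) (closed seqGlue X f) pt H P b)

/-- The type of `nullSeqInd`. -/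
def nullSeqIndType : Exp :=
  pi (arr nat (U 0)) fun X => pi (pi nat fun n => arr (X n) (X (succ n))) fun f =>
    pi (pi nat fun n => X (succ n)) fun pt =>
      pi (pi nat fun n => pi (X n) fun x => eq (X (succ n)) (pt n) (f n x)) fun _ =>
        pi (arr (seqColim X f) (U 1)) fun P => arr (P (seqIn X f (succ zero) (pt zero)))
          (pi (seqColim X f) fun z => P z)

/-- The signature up to `nullSeqInd`. -/
def Signature.withNullSeqInd : Signature := withSeqColimInd.extend nullSeqInd nullSeqIndType

set_option maxHeartbeats 0 in
theorem Signature.withNullSeqInd_sound : withNullSeqInd.Sound :=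
  withSeqColimInd_sound.extend (by decide +kernel)

end HoTT

namespace HoTT

open Exp

/-! ### Mere propositions -/

/-- Function extensionality. -/
def homotopyToEq : Exp :=
  lam fun A => lam fun B => lam fun f => lam fun g =>
    let X := eq (pi A fun x => B x) f g
    let Y := pi A fun x => eq (B x) (f x) (g x)
    let F := happly A (fun x => B x) f g
    let R := fun h => pi Y fun b => eq Y (F (h b)) b
    let L := sig (arr Y X) fun h => pi X fun a => eq X (h (F a)) a
    fst (arr Y X) R (fst (sig (arr Y X) R) (fun _ => L) (cst .funext A B f g))

/-- The type of `homotopyToEq`. -/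
def homotopyToEqType : Exp :=
  pi (U 1) fun A => pi (arr A (U 1)) fun B => pi (pi A fun x => B x) fun f =>
    pi (pi A fun x => B x) fun g =>
      arr (pi A fun x => eq (B x) (f x) (g x)) (eq (pi A fun x => B x) f g)

/-- The signature up to `homotopyToEq`. -/
def Signature.withHomotopyToEq : Signature := withNullSeqInd.extend homotopyToEq homotopyToEqType

set_option maxHeartbeats 0 in
theorem Signature.withHomotopyToEq_sound : withHomotopyToEq.Sound :=
  withNullSeqInd_sound.extend (by decide +kernel)

/-- Two paths from `a` give a path between their end points. -/
def pathBetween : Exp :=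
  lam fun A => lam fun a => lam fun b => lam fun c => lam fun p => lam fun q =>
    closed pathInd A a (lam fun b => lam fun _ => eq A b c) q b p

/-- The type of `pathBetween`. -/
def pathBetweenType : Exp :=
  pi (U 1) fun A => pi A fun a => pi A fun b => pi A fun c =>
    arr (eq A a b) (arr (eq A a c) (eq A b c))

/-- The signature up to `pathBetween`. -/
def Signature.withPathBetween : Signature := withHomotopyToEq.extend pathBetween pathBetweenType

set_option maxHeartbeats 0 in
theorem Signature.withPathBetween_sound : withPathBetween.Sound :=
  withHomotopyToEq_sound.extend (by decide +kernel)

/-- The path from `b` to itself that comes from twice the same path is trivial. -/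
def pathBetweenSelf : Exp :=
  lam fun A => lam fun a => lam fun b => lam fun p =>
    closed pathInd A a
      (lam fun b => lam fun p => eq (eq A b b) (closed pathBetween A a b b p p) (refl A b))
      (refl (eq A a a) (refl A a)) b p

/-- The type of `pathBetweenSelf`. -/
def pathBetweenSelfType : Exp :=
  pi (U 1) fun A => pi A fun a => pi A fun b => pi (eq A a b) fun p =>
    eq (eq A b b) (closed pathBetween A a b b p p) (refl A b)

/-- The signature up to `pathBetweenSelf`. -/
def Signature.withPathBetweenSelf : Signature :=
  withPathBetween.extend pathBetweenSelf pathBetweenSelfType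

set_option maxHeartbeats 0 in
theorem Signature.withPathBetweenSelf_sound : withPathBetweenSelf.Sound :=
  withPathBetween_sound.extend (by decide +kernel)

/-- Every path in a mere proposition is equal to a canonical one. -/
def propPathCanonical : Exp :=
  lam fun A => lam fun q => lam fun x => lam fun y => lam fun p =>
    closed pathInd A x
      (lam fun y => lam fun p =>
        eq (eq A x y) (closed pathBetween A x x y (q x x) (q x y)) p)
      (closed pathBetweenSelf A x x (q x x)) y p

/-- The type of `propPathCanonical`. -/
def propPathCanonicalType : Exp :=
  pi (U 1) fun A => pi (isProp A) fun q => pi A fun x => pi A fun y => pi (eq A x y) fun p =>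
    eq (eq A x y) (closed pathBetween A x x y (q x x) (q x y)) p

/-- The signature up to `propPathCanonical`. -/
def Signature.withPropPathCanonical : Signature :=
  withPathBetweenSelf.extend propPathCanonical propPathCanonicalType

set_option maxHeartbeats 0 in
theorem Signature.withPropPathCanonical_sound : withPropPathCanonical.Sound :=
  withPathBetweenSelf_sound.extend (by decide +kernel)

/-- Being a mere proposition is a mere proposition. -/
def isPropIsProp : Exp :=
  lam fun A => lam fun q => lam fun r =>
    closed homotopyToEq A (lam fun x => pi A fun y => eq A x y) q r (lam fun x =>
      closed homotopyToEq A (lam fun y => eq A x y) (q x) (r x) (lam fun y =>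
        -- Both `q x y` and `r x y` equal the canonical path built from `q`.
        closed pathBetween (eq A x y) (closed pathBetween A x x y (q x x) (q x y)) (q x y) (r x y)
          (closed propPathCanonical A q x y (q x y)) (closed propPathCanonical A q x y (r x y))))

/-- The type of `isPropIsProp`. -/
def isPropIsPropType : Exp := pi (U 1) fun A => isProp (isProp A)

/-- The signature up to `isPropIsProp`. -/
def Signature.withIsPropIsProp : Signature :=
  withPropPathCanonical.extend isPropIsProp isPropIsPropType

set_option maxHeartbeats 0 in
theorem Signature.withIsPropIsProp_sound : withIsPropIsProp.Sound :=
  withPropPathCanonical_sound.extend (by decide +kernel)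

/-- A function from the vertices to a mere proposition extends to the graph quotient. -/
def gqToProp : Exp :=
  lam fun V => lam fun E => lam fun B => lam fun q => lam fun c =>
    cst .gqElim V E (lam fun _ => B) c
      (lam fun v => lam fun w => lam fun e =>
        q (transport (gq V E) (fun _ => B) (vert V E v) (vert V E w) (edge V E v w e) (c v)) (c w))

/-- The type of `gqToProp`. -/
def gqToPropType : Exp :=
  pi (U 0) fun V => pi (arr V (arr V (U 0))) fun E => pi (U 1) fun B => arr (isProp B)
    (arr (arr V B) (arr (gq V E) B))

/-- The signature up to `gqToProp`. -/
def Signature.withGqToProp : Signature := withIsPropIsProp.extend gqToProp gqToPropType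

set_option maxHeartbeats 0 in
theorem Signature.withGqToProp_sound : withGqToProp.Sound :=
  withIsPropIsProp_sound.extend (by decide +kernel)

/-! ### Sequences of null-homotopic maps -/

/-- The colimit of a sequence of null-homotopic maps is a mere proposition. -/
def nullSeqIsProp : Exp :=
  lam fun X => lam fun f => lam fun pt => lam fun H => lam fun x => lam fun y =>
    -- `c` contracts the colimit onto its first base point.
    let c := closed nullSeqInd X f pt H
      (lam fun z => eq (seqColim X f) (seqIn X f (succ zero) (pt zero)) z)
      (refl (seqColim X f) (seqIn X f (succ zero) (pt zero)))
    closed pathBetween (seqColim X f) (seqIn X f (succ zero) (pt zero)) x y (c x) (c y)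

/-- The type of `nullSeqIsProp`. -/
def nullSeqIsPropType : Exp :=
  pi (arr nat (U 0)) fun X => pi (pi nat fun n => arr (X n) (X (succ n))) fun f =>
    pi (pi nat fun n => X (succ n)) fun pt =>
      arr (pi nat fun n => pi (X n) fun x => eq (X (succ n)) (pt n) (f n x))
        (isProp (seqColim X f))

/-- The signature up to `nullSeqIsProp`. -/
def Signature.withNullSeqIsProp : Signature := withGqToProp.extend nullSeqIsProp nullSeqIsPropType

set_option maxHeartbeats 0 in
theorem Signature.withNullSeqIsProp_sound : withNullSeqIsProp.Sound :=
  withGqToProp_sound.extend (by decide +kernel)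

/-- Null homotopies for all maps of a sequence, in terms of the first one and the others. -/
def nullSeqCases : Exp :=
  lam fun X => lam fun f => lam fun pt => lam fun h => lam fun h' => lam fun n =>
    cst .natElim (lam fun n => pi (X n) fun x => eq (X (succ n)) (pt n) (f n x)) h
      (lam fun n => lam fun _ => h' n) n

/-- The type of `nullSeqCases`. -/
def nullSeqCasesType : Exp :=
  pi (arr nat (U 0)) fun X => pi (pi nat fun n => arr (X n) (X (succ n))) fun f =>
    pi (pi nat fun n => X (succ n)) fun pt =>
      arr (pi (X zero) fun x => eq (X (succ zero)) (pt zero) (f zero x))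
        (arr (pi nat fun n => pi (X (succ n)) fun x =>
            eq (X (succ (succ n))) (pt (succ n)) (f (succ n) x))
          (pi nat fun n => pi (X n) fun x => eq (X (succ n)) (pt n) (f n x)))

/-- The signature up to `nullSeqCases`. -/
def Signature.withNullSeqCases : Signature := withNullSeqIsProp.extend nullSeqCases nullSeqCasesType

set_option maxHeartbeats 0 in
theorem Signature.withNullSeqCases_sound : withNullSeqCases.Sound :=
  withNullSeqIsProp_sound.extend (by decide +kernel)

/-! ### The propositional truncation -/

/-- The edges of the graph whose quotient is the join. -/
def joinEdges (A B : Exp) : Exp :=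
  pushoutEdges (prod A B) A B (lam fun s => fst A (fun _ => B) s)
    (lam fun s => snd A (fun _ => B) s)

/-- A function from `A` to a mere proposition extends to the join powers of `A`. -/
def joinPowerToProp : Exp :=
  lam fun A => lam fun B => lam fun q => lam fun g => lam fun n =>
    cst .natElim (lam fun n => arr (joinPower 0 A n) B) g
      (lam fun n => lam fun h =>
        closed gqToProp (sum A (joinPower 0 A n)) (joinEdges A (joinPower 0 A n)) B q
          (lam fun v => cst .sumElim A (joinPower 0 A n) (lam fun _ => B) g h v)) n

/-- The type of `joinPowerToProp`. -/
def joinPowerToPropType : Exp :=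
  pi (U 0) fun A => pi (U 1) fun B => arr (isProp B) (arr (arr A B)
    (pi nat fun n => arr (joinPower 0 A n) B))

/-- The signature up to `joinPowerToProp`. -/
def Signature.withJoinPowerToProp : Signature :=
  withNullSeqCases.extend joinPowerToProp joinPowerToPropType

set_option maxHeartbeats 0 in
theorem Signature.withJoinPowerToProp_sound : withJoinPowerToProp.Sound :=
  withNullSeqCases_sound.extend (by decide +kernel)

/-- A function from `A` to a mere proposition extends to the truncation of `A`. -/
def truncToProp : Exp :=
  lam fun A => lam fun B => lam fun q => lam fun g =>
    closed gqToProp (seqVertices (joinSeq 0 A)) (seqEdges (joinSeq 0 A) (joinSeqMap 0 A)) B q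
      (lam fun v => cst .sigElim nat (lam fun n => joinSeq 0 A n) (lam fun _ => B)
        (lam fun n => cst .natElim (lam fun n => arr (joinSeq 0 A n) B)
          (lam fun x => cst .emptyElim (lam fun _ => B) x)
          (lam fun n => lam fun _ => closed joinPowerToProp A B q g n) n) v)

/-- The type of `truncToProp`. -/
def truncToPropType : Exp :=
  pi (U 0) fun A => pi (U 1) fun B => arr (isProp B) (arr (arr A B) (arr (trunc 0 A) B))

/-- The signature up to `truncToProp`. -/
def Signature.withTruncToProp : Signature := withJoinPowerToProp.extend truncToProp truncToPropType

set_option maxHeartbeats 0 in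
theorem Signature.withTruncToProp_sound : withTruncToProp.Sound :=
  withJoinPowerToProp_sound.extend (by decide +kernel)

/-- The base points of the join powers of a pointed type. -/
def joinPoint : Exp :=
  lam fun A => lam fun a => lam fun n =>
    cst .natElim (lam fun n => joinSeq 0 A (succ n)) a
      -- Stage `1` is `A`, with base point `a`; every later stage is a join, with base point `inl
      -- a`.
      (lam fun n => lam fun _ => vert (sum A (joinPower 0 A n)) (joinEdges A (joinPower 0 A n))
        (cst .inl A (joinPower 0 A n) a)) n

/-- The type of `joinPoint`. -/
def joinPointType : Exp :=
  pi (U 0) fun A => pi A fun _ => pi nat fun n => joinSeq 0 A (succ n)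

/-- The signature up to `joinPoint`. -/
def Signature.withJoinPoint : Signature := withTruncToProp.extend joinPoint joinPointType

set_option maxHeartbeats 0 in
theorem Signature.withJoinPoint_sound : withJoinPoint.Sound :=
  withTruncToProp_sound.extend (by decide +kernel)

/-- The path between the two ends of the join. -/
def joinGlue : Exp :=
  lam fun A => lam fun B => lam fun a => lam fun b =>
    let l := cst .inl A B a
    let r := cst .inr A B b
    edge (sum A B) (joinEdges A B) l r
      (pair (prod A B)
        (fun s => prod (eq (sum A B) (cst .inl A B (fst A (fun _ => B) s)) l)
          (eq (sum A B) (cst .inr A B (snd A (fun _ => B) s)) r))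
        (pair A (fun _ => B) a b)
        (pair (eq (sum A B) l l) (fun _ => eq (sum A B) r r)
          (refl (sum A B) l) (refl (sum A B) r)))

/-- The type of `joinGlue`. -/
def joinGlueType : Exp :=
  pi (U 0) fun A => pi (U 0) fun B => pi A fun a => pi B fun b =>
    eq (join A B) (vert (sum A B) (joinEdges A B) (cst .inl A B a)) (joinInr A B b)

/-- The signature up to `joinGlue`. -/
def Signature.withJoinGlue : Signature := withJoinPoint.extend joinGlue joinGlueType

set_option maxHeartbeats 0 in
theorem Signature.withJoinGlue_sound : withJoinGlue.Sound :=
  withJoinPoint_sound.extend (by decide +kernel)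

/-- The truncation of a pointed type is a mere proposition. -/
def truncIsPropOfPoint : Exp :=
  lam fun A => lam fun a =>
    closed nullSeqIsProp (joinSeq 0 A) (joinSeqMap 0 A) (closed joinPoint A a)
      (closed nullSeqCases (joinSeq 0 A) (joinSeqMap 0 A) (closed joinPoint A a)
        (lam fun x => cst .emptyElim (lam fun x =>
          eq (joinSeq 0 A (succ zero)) (closed joinPoint A a zero) (joinSeqMap 0 A zero x)) x)
        -- The target's base point is `inl a` and the map is `inr`, so the path of the join over
        -- `(a, x)` is the null homotopy.
        (lam fun n => lam fun x => closed joinGlue A (joinPower 0 A n) a x))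

/-- The type of `truncIsPropOfPoint`. -/
def truncIsPropOfPointType : Exp := pi (U 0) fun A => pi A fun _ => isProp (trunc 0 A)

/-- The signature up to `truncIsPropOfPoint`. -/
def Signature.withTruncIsPropOfPoint : Signature :=
  withJoinGlue.extend truncIsPropOfPoint truncIsPropOfPointType

set_option maxHeartbeats 0 in
theorem Signature.withTruncIsPropOfPoint_sound : withTruncIsPropOfPoint.Sound :=
  withJoinGlue_sound.extend (by decide +kernel)

/-- A type `T` is a mere proposition if it is one for every point of `A` and if functions from `A`
to mere propositions extend to `T`. -/
def isPropOfExtension : Exp :=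
  lam fun _ => lam fun T => lam fun c => lam fun ext => lam fun x =>
    -- The map `c` extends to `T → isProp T`. The first `x` is the point that makes `T` a mere
    -- proposition, the second one is an end point of the path sought.
    ext (isProp T) (closed isPropIsProp T) c x x

/-- The type of `isPropOfExtension`. -/
def isPropOfExtensionType : Exp :=
  pi (U 0) fun A => pi (U 0) fun T => arr (arr A (isProp T))
    (arr (pi (U 1) fun B => arr (isProp B) (arr (arr A B) (arr T B))) (isProp T))

/-- The signature up to `isPropOfExtension`. -/
def Signature.withIsPropOfExtension : Signature :=
  withTruncIsPropOfPoint.extend isPropOfExtension isPropOfExtensionType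

set_option maxHeartbeats 0 in
theorem Signature.withIsPropOfExtension_sound : withIsPropOfExtension.Sound :=
  withTruncIsPropOfPoint_sound.extend (by decide +kernel)

/-- The truncation is a mere proposition. -/
def truncIsProp : Exp :=
  lam fun A => closed isPropOfExtension A (trunc 0 A) (closed truncIsPropOfPoint A)
    (closed truncToProp A)

/-- The type of `truncIsProp`. -/
def truncIsPropType : Exp := pi (U 0) fun A => isProp (trunc 0 A)

set_option maxHeartbeats 0 in
theorem valid_truncIsProp : Valid [] truncIsProp.close truncIsPropType.close :=
  Signature.withIsPropOfExtension_sound.accepts wellFormed_nil (by decide +kernel)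

/-- Precomposition with a map `A → V → gq V E` is an equivalence of functions to a mere
proposition if functions from `A` to mere propositions extend to `gq V E`. -/
def precompEquiv : Exp :=
  lam fun A => lam fun V => lam fun E => lam fun i => lam fun ext => lam fun B => lam fun q =>
    let X := arr (gq V E) B
    let Y := arr A B
    let F := lam fun g => lam fun a => g (vert V E (i a))
    let R := fun h => pi Y fun b => eq Y (F (h b)) b
    let L := fun h => pi X fun u => eq X (h (F u)) u
    pair (sig (arr Y X) R) (fun _ => sig (arr Y X) L)
      -- Extension is the inverse on both sides: the two functions compared take values in the mere
      -- proposition `B`, so they agree pointwise by `q`.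
      (pair (arr Y X) R (ext B q) (lam fun b =>
        closed homotopyToEq A (lam fun _ => B) (lam fun a => ext B q b (vert V E (i a))) b
          (lam fun a => q (ext B q b (vert V E (i a))) (b a))))
      (pair (arr Y X) L (ext B q) (lam fun u =>
        closed homotopyToEq (gq V E) (lam fun _ => B)
          (ext B q (lam fun a => u (vert V E (i a)))) u
          (lam fun z => q (ext B q (lam fun a => u (vert V E (i a))) z) (u z))))

/-- The type of `precompEquiv`. -/
def precompEquivType : Exp :=
  pi (U 0) fun A => pi (U 0) fun V => pi (arr V (arr V (U 0))) fun E => pi (arr A V) fun i =>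
    arr (pi (U 1) fun B => arr (isProp B) (arr (arr A B) (arr (gq V E) B)))
      (pi (U 1) fun B => arr (isProp B)
        (isEquiv (arr (gq V E) B) (arr A B) (lam fun g => lam fun a => g (vert V E (i a)))))

/-- The signature up to `precompEquiv`. -/
def Signature.withPrecompEquiv : Signature :=
  withIsPropOfExtension.extend precompEquiv precompEquivType

set_option maxHeartbeats 0 in
theorem Signature.withPrecompEquiv_sound : withPrecompEquiv.Sound :=
  withIsPropOfExtension_sound.extend (by decide +kernel)

/-- The universal property of the truncation. -/
def truncUniversal : Exp :=
  lam fun A =>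
    closed precompEquiv A (seqVertices (joinSeq 0 A)) (seqEdges (joinSeq 0 A) (joinSeqMap 0 A))
      -- The partially applied pair is the inclusion of stage `1`, which is convertible to `A`,
      -- among the vertices.
      (cst .pair nat (lam fun n => joinSeq 0 A n) (succ zero)) (closed truncToProp A)

/-- The type of `truncUniversal`. -/
def truncUniversalType : Exp :=
  pi (U 0) fun A => pi (U 1) fun B => arr (isProp B)
    (isEquiv (arr (trunc 0 A) B) (arr A B) (lam fun g => lam fun a => g (truncIn 0 A a)))

set_option maxHeartbeats 0 in
theorem valid_truncUniversal : Valid [] truncUniversal.close truncUniversalType.close :=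
  Signature.withPrecompEquiv_sound.accepts wellFormed_nil (by decide +kernel)

/-- The truncation, as a function. -/
def truncMap : Exp := lam fun A => trunc 0 A

/-- The type of `truncMap`. -/
def truncMapType : Exp := arr (U 0) (U 0)

set_option maxHeartbeats 0 in
theorem valid_truncMap : Valid [] truncMap.close truncMapType.close :=
  Signature.withPrecompEquiv_sound.accepts wellFormed_nil (by decide +kernel)

/-- The map to the truncation, as a function. -/
def truncInMap : Exp := lam fun A => lam fun a => truncIn 0 A a

/-- The type of `truncInMap`. -/
def truncInMapType : Exp := pi (U 0) fun A => arr A (trunc 0 A)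

set_option maxHeartbeats 0 in
theorem valid_truncInMap : Valid [] truncInMap.close truncInMapType.close :=
  Signature.withPrecompEquiv_sound.accepts wellFormed_nil (by decide +kernel)

end HoTT

namespace HoTT

section

open Tm

/-! ### Transfer to arbitrary universes -/

namespace HasType

variable {k : ℕ} {Γ : List Tm}

/-- Moving the argument of a function into the context allows its universe to be changed by `narrow`
before abstracting again. -/
theorem app_var {A B f : Tm} (h : HasType k Γ f (Tm.pi A B)) :
    HasType k (A :: Γ) (Tm.app (f.rename Nat.succ) (Tm.var 0)) B := by
  have h := HasType.app (h.weaken A) (.var (n := 0) (A := A) rfl)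
  have e : (B.rename (up Nat.succ)).inst (Tm.var 0) = B := by
    rw [Tm.inst, subst_rename]
    refine (congrArg (Tm.subst · B) ?_).trans (subst_var B)
    funext n
    cases n <;> rfl
  rwa [e] at h

/-- The universe of a variable may be replaced by a smaller one. -/
theorem narrow {t A : Tm} {i j : ℕ} (hij : i ≤ j) (h : HasType k (Tm.univ j :: Γ) t A) :
    HasType k (Tm.univ i :: Γ) t A := by
  rw [← subst_var t, ← subst_var A]
  refine h.subst fun n B hn => ?_
  rw [subst_var]
  cases n with
  | zero =>
    obtain rfl : Tm.univ j = B := by simpa using hn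
    exact (HasType.var (n := 0) (A := Tm.univ i) rfl).cumul_le hij
  | succ n => exact .var (by simpa using hn)

end HasType

end

open Exp

/-- The strictly monotone map with values `k` at `0` and `m + n` at `n + 1`. -/
def levelMap (k m : ℕ) : ℕ → ℕ
  | 0 => k
  | n + 1 => m + n

theorem strictMono_levelMap {k m : ℕ} (h : k < m) : StrictMono (levelMap k m) := by
  refine strictMono_nat_of_lt_succ fun n => ?_
  cases n with
  | zero => exact h
  | succ n => exact Nat.lt_succ_self (m + n)

theorem Valid.hasType {t A : Tm} (h : Valid [] t A) (k : ℕ) {m : ℕ} (hm : k < m) :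
    HasType k [] (t.mapLevels (levelMap k m)) (A.mapLevels (levelMap k m)) :=
  h.1.mapLevels (strictMono_levelMap hm)

theorem mapLevels_truncMap (k m : ℕ) :
    truncMap.close.mapLevels (levelMap k m) = (lam fun A => trunc k A).close := rfl

theorem mapLevels_truncInMap (k m : ℕ) :
    truncInMap.close.mapLevels (levelMap k m) = (lam fun A => lam fun a => truncIn k A a).close :=
  rfl

theorem mapLevels_truncInMapType (k m : ℕ) :
    truncInMapType.close.mapLevels (levelMap k m) =
      (pi (U k) fun A => arr A (trunc k A)).close :=
  rfl

theorem mapLevels_truncIsPropType (k m : ℕ) :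
    truncIsPropType.close.mapLevels (levelMap k m) =
      (pi (U k) fun A => isProp (trunc k A)).close :=
  rfl

/-- The levels `0` and `1` of the checked type become `k` and `m`. -/
theorem mapLevels_truncUniversalType (k m : ℕ) :
    truncUniversalType.close.mapLevels (levelMap k m) =
      (pi (U k) fun A => pi (U m) fun B => arr (isProp B) (isEquiv (arr (trunc k A) B) (arr A B)
        (lam fun g => lam fun a => g (truncIn k A a)))).close :=
  rfl

end HoTT

open HoTT HoTT.Exp in
theorem mainTheorem5 (k : ℕ) :
    HasType k [] (lam fun A => trunc k A).close (arr (U k) (U k)).close ∧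
    HasType k [] (lam fun A => lam fun a => truncIn k A a).close
      (pi (U k) fun A => arr A (trunc k A)).close ∧
    IsInhabited k (pi (U k) fun A => isProp (trunc k A)) ∧
    ∀ j : ℕ, IsInhabited k (pi (U k) fun A => pi (U j) fun B => arr (isProp B)
      (isEquiv (arr (trunc k A) B) (arr A B) (lam fun g => lam fun a => g (truncIn k A a)))) := by
  have hk : k < k + 1 := Nat.lt_succ_self k
  refine ⟨?_, ?_, ?_, fun j => ?_⟩
  · have h := valid_truncMap.hasType k hk
    rw [mapLevels_truncMap] at h
    exact h
  · have h := valid_truncInMap.hasType k hk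
    rwa [mapLevels_truncInMap, mapLevels_truncInMapType] at h
  · have h := valid_truncIsProp.hasType k hk
    rw [mapLevels_truncIsPropType] at h
    exact ⟨_, h⟩
  -- The level must exceed `k` for `levelMap` to be strictly monotone and be at least `j` for `U j`
  -- to be included. Afterwards the variable `B` is restricted to `U j`, which also covers `j ≤ k`.
  · have h := valid_truncUniversal.hasType k (m := max j (k + 1)) (by omega)
    rw [mapLevels_truncUniversalType] at h
    exact ⟨_, .lam (.univ k) (.lam (.univ j) (.narrow (le_max_left _ _) h.app_var.app_var))⟩
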